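/- Consider programs of a fixed deterministic WHILE language over binary trees which may call a SAT solver. A SAT solver takes a formula $\varphi$ in conjunctive normal form and returns a satisfying valuation of its variables if there is one, and the answer "unsatisfiable" otherwise. The running time of a program counts every instruction with one plus the size of the datum it is applied to (plus the size of the answer, for a solver call), but not the work of the solver. For a finite non-empty alphabet $\Sigma$, a finite set $\mathcal P\subseteq\Sigma^*$ and an integer $n\ge 1$, let $\mathsf{Rec}(\mathcal P,n)$ be the set of complete deterministic finite automata $\mathcal A$ over $\Sigma$ with at most $n$ states whose language $\mathcal L(\mathcal A)$ contains $\mathcal P$, let $\Sigma^{\le h}$ be the set of words of length at most $h$, and let $\mathsf{Pref}(\mathcal P)$ be the set of prefixes of words of $\mathcal P$. There are one such program and a constant $c$ such that, for every SAT solver, all $\Sigma$, $\mathcal P$ and $n$ as above, the program, given $|\Sigma|$, $n$ and any repetition-free list of the words of $\mathcal P$ (with $\Sigma=\{0,\dots,|\Sigma|-1\}$ and numbers written in unary), halts and outputs an automaton $\mathcal A\in\mathsf{Rec}(\mathcal P,n)$ such that no $\mathcal A'\in\mathsf{Rec}(\mathcal P,n)$ satisfies $|\mathcal L(\mathcal A')\cap\Sigma^{\le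 2n-2}|<|\mathcal L(\mathcal A)\cap\Sigma^{\le 2n-2}|$. Moreover: 1. it calls the SAT solver at most $c\,(|\Sigma|+n)^c$ times, and at most $(2n-1)\cdot\log_2|\Sigma|$ times if $|\Sigma|\ge 2$; 2. every formula on which it calls the solver has size at most $c\,(|\Sigma|+|\mathsf{Pref}(\mathcal P)|+n)^c$; 3. its running time is at most $c\,(|\Sigma|+|\mathsf{Pref}(\mathcal P)|+n)^c$. -/

import Mathlib

namespace DFALearning

/-! ### Automata and the learning task -/

/-- A DFA over the alphabet `α`: a finite type of states together with a Mathlib `DFA` on it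
(the initial state makes the type of states non-empty). -/
structure FinDFA (α : Type) where
  State : Type
  [fintypeState : Fintype State]
  toDFA : DFA α State

attribute [instance] FinDFA.fintypeState

variable {α : Type}

/-- The number of states. -/
def FinDFA.size (A : FinDFA α) : ℕ := Fintype.card A.State

/-- The accepted words. -/
def FinDFA.lang (A : FinDFA α) : Set (List α) := {w | w ∈ A.toDFA.accepts}

/-- The number of accepted words of length at most `h` (the alphabet will be finite). -/
noncomputable def FinDFA.count (A : FinDFA α) (h : ℕ) : ℕ :=
  {w : List α | w ∈ A.lang ∧ w.length ≤ h}.ncard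

/-- The DFAs with at most `n` states that accept all words of `P`. -/
def Rec (P : Set (List α)) (n : ℕ) : Set (FinDFA α) :=
  {A | A.size ≤ n ∧ P ⊆ A.lang}

/-- The order `≺_h`: `A` accepts fewer words of length at most `h` than `B`. -/
def CountLT (h : ℕ) (A B : FinDFA α) : Prop := A.count h < B.count h

/-- `A` belongs to `S` and no element of `S` is below `A`. -/
def IsMinimalIn (S : Set (FinDFA α)) (r : FinDFA α → FinDFA α → Prop) (A : FinDFA α) : Prop :=
  A ∈ S ∧ ∀ B ∈ S, ¬ r B A

/-- `A` is a solution of the word-counting learning task for the positive words `P` and the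
bound `n` on the number of states. -/
def SolvesTask (P : Set (List α)) (n : ℕ) (A : FinDFA α) : Prop :=
  IsMinimalIn (Rec P n) (CountLT (2 * n - 2)) A

/-- The set of prefixes of words of `P`. -/
def Pref (P : Set (List α)) : Set (List α) := {u | ∃ w ∈ P, u <+: w}

/-! ### Propositional formulas and SAT solvers -/

/-- Formulas in conjunctive normal form. A formula is a list of clauses, a clause is a list of
literals, and the literal `(i, b)` says that the variable `i` has the value `b`. -/
abbrev Cnf : Type := List (List (ℕ × Bool))

/-- The valuation `v` satisfies the formula `φ`. -/
def Cnf.Sat (v : ℕ → Bool) (φ : Cnf) : Prop := ∀ C ∈ φ, ∃ l ∈ C, v l.1 = l.2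

/-- All variables that occur in `φ` are smaller than `φ.numVars`, and it is the least such
number. -/
def Cnf.numVars (φ : Cnf) : ℕ := (φ.flatten.map fun l => l.1 + 1).foldr max 0

/-- A SAT solver: it returns a satisfying valuation of each satisfiable formula, and reports
that there is none for the others. -/
structure SatSolver where
  solve : Cnf → Option (ℕ → Bool)
  sound : ∀ φ v, solve φ = some v → Cnf.Sat v φ
  complete : ∀ φ, solve φ = none → ∀ v, ¬ Cnf.Sat v φ

/-! ### Data and their encodings -/

/-- The data on which programs compute: binary trees. -/
inductive Data : Type
  | nil : Data
  | cons : Data → Data → Data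

/-- The number of nodes. -/
def Data.size : Data → ℕ
  | .nil => 1
  | .cons a b => 1 + a.size + b.size

def Data.hd : Data → Data
  | .nil => .nil
  | .cons a _ => a

def Data.tl : Data → Data
  | .nil => .nil
  | .cons _ b => b

/-- Lists as data. -/
def encList {β : Type} (f : β → Data) : List β → Data
  | [] => .nil
  | b :: l => .cons (f b) (encList f l)

/-- Natural numbers, in unary. -/
def encNat : ℕ → Data
  | 0 => .nil
  | k + 1 => .cons .nil (encNat k)

def encBool : Bool → Data
  | false => .nil
  | true => .cons .nil .nil

def encCnf (φ : Cnf) : Data :=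
  encList (encList fun l : ℕ × Bool => .cons (encBool l.2) (encNat l.1)) φ

/-- The size of a formula, as the input of a SAT solver. -/
def Cnf.size (φ : Cnf) : ℕ := (encCnf φ).size

/-- The answer of a SAT solver to the query `φ`, as it is handed to the program: `nil` for
`unsatisfiable`, otherwise the list of the values of the variables `0, …, φ.numVars - 1`. -/
def encAnswer (φ : Cnf) : Option (ℕ → Bool) → Data
  | none => .nil
  | some v => .cons .nil (encList encBool ((List.range φ.numVars).map v))

/-- The input of the learning task: the number of letters, the bound on the number of states,
and a list of the positive words. -/
def encInput (m n : ℕ) (l : List (List (Fin m))) : Data :=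
  .cons (encNat m) (.cons (encNat n) (encList (encList fun a : Fin m => encNat a) l))

open Classical in
/-- A DFA with states `0, …, s - 1`: its initial state, its transition table (one row for each
state, with one entry for each letter), and the list of truth values that says which states
are final. -/
noncomputable def encDFA {m s : ℕ} (A : DFA (Fin m) (Fin s)) : Data :=
  .cons (encNat A.start)
    (.cons
      (encList (fun q : Fin s => encList (fun a : Fin m => encNat (A.step q a)) (List.finRange m))
        (List.finRange s))
      (encList (fun q : Fin s => encBool (decide (q ∈ A.accept))) (List.finRange s)))

/-! ### Programs that call a SAT solver -/

/-- Programs of a small WHILE language over binary trees; each program transforms one datum.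
A test asks whether the head of the current datum is different from `nil`. -/
inductive Prog : Type
  | id : Prog
  | nil : Prog
  | hd : Prog
  | tl : Prog
  /-- run both programs on the current datum, and pair the results -/
  | pair : Prog → Prog → Prog
  /-- run the first program, then the second one on the result -/
  | seq : Prog → Prog → Prog
  /-- run the first program if the test succeeds, and the second one otherwise -/
  | cond : Prog → Prog → Prog
  /-- run the program repeatedly, as long as the test succeeds -/
  | loop : Prog → Prog
  /-- call the SAT solver on the formula encoded by the current datum -/
  | ask : Prog

/-- `Run S p x y t qs`: with the SAT solver `S`, the program `p` halts on the input `x` with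
output `y`, in time `t`, and `qs` is the list of formulas on which it calls the solver (in order,
with repetitions). Every instruction costs one unit plus the size of the datum
to which it is applied; a call of the solver costs in addition the size of the answer, but the
work of the solver is not counted. -/
inductive Run (S : SatSolver) : Prog → Data → Data → ℕ → List Cnf → Prop
  | id (x : Data) : Run S .id x x (1 + x.size) []
  | nil (x : Data) : Run S .nil x .nil (1 + x.size) []
  | hd (x : Data) : Run S .hd x x.hd (1 + x.size) []
  | tl (x : Data) : Run S .tl x x.tl (1 + x.size) []
  | pair {p q : Prog} {x y z : Data} {t u : ℕ} {ps qs : List Cnf}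
      (hp : Run S p x y t ps) (hq : Run S q x z u qs) :
      Run S (.pair p q) x (.cons y z) (1 + x.size + t + u) (ps ++ qs)
  | seq {p q : Prog} {x y z : Data} {t u : ℕ} {ps qs : List Cnf}
      (hp : Run S p x y t ps) (hq : Run S q y z u qs) :
      Run S (.seq p q) x z (1 + x.size + t + u) (ps ++ qs)
  | condTrue {p q : Prog} {x y : Data} {t : ℕ} {ps : List Cnf}
      (hx : x.hd ≠ .nil) (hp : Run S p x y t ps) :
      Run S (.cond p q) x y (1 + x.size + t) ps
  | condFalse {p q : Prog} {x y : Data} {t : ℕ} {qs : List Cnf}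
      (hx : x.hd = .nil) (hq : Run S q x y t qs) :
      Run S (.cond p q) x y (1 + x.size + t) qs
  | loopStop {p : Prog} {x : Data} (hx : x.hd = .nil) :
      Run S (.loop p) x x (1 + x.size) []
  | loopStep {p : Prog} {x y z : Data} {t u : ℕ} {ps qs : List Cnf}
      (hx : x.hd ≠ .nil) (hp : Run S p x y t ps) (hq : Run S (.loop p) y z u qs) :
      Run S (.loop p) x z (1 + x.size + t + u) (ps ++ qs)
  | ask (φ : Cnf) :
      Run S .ask (encCnf φ) (encAnswer φ (S.solve φ))
        (1 + (encCnf φ).size + (encAnswer φ (S.solve φ)).size) [φ]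

end DFALearning

namespace DFALearning

open Polynomial

/-! ### Polynomial bounds -/

/-! Write m = |Σ| and r = 2n - 1. Up to renaming, an automaton with at most n states is a transition
function δ and a set of final states on the numbers 0, …, n - 1, started in 0. The number of words
of length less than i + 1 accepted from q is [q final] plus the sum over the letters a of the number
of words of length less than i accepted from δ(q, a). These numbers can be exponential, but they are
at most 1 + m + … + m^(r-1) and so have polynomially many binary digits. Hence the recursion up to r
can be written in conjunctive normal form with ripple-carry adders, in polynomial size. Prescribing
bits of the final count only adds unit clauses. `formula_sound` and `formula_complete` say that such
a formula is satisfiable exactly when a suitable automaton exists, and that the automaton can be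
read off a satisfying valuation.

The least count μ is found from its top bit downwards: each query asks for an automaton with the
bits already known and the next bit 0. A positive answer makes this bit 0 and yields a new
automaton, a negative one makes it 1 (`SearchInv.of_sat`, `SearchInv.of_unsat`). After the last bit
the stored automaton is optimal. There is one query per digit of the geometric sum, which is at most
r · log₂ m for m ≥ 2 (`geomSize_le_logb`).

For the running time, `PT` collects the functions with a polynomial-time program that never calls
the solver. It is closed under composition, pairing, case distinction and list operations, so
`fun_prop` produces the programs that write the formulas and read the automata. Only the loop around
the solver (`exists_search_step`, `exists_program`) is an explicit program. Finally, the input size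
is polynomial in m + |Pref(P)| + n (`esize_input_le`). -/

theorem eval_mono (P : ℕ[X]) {a b : ℕ} (h : a ≤ b) : P.eval a ≤ P.eval b := by
  rw [eval_eq_sum_range, eval_eq_sum_range]
  gcongr

theorem exists_eval_le_mul_pow (P : ℕ[X]) : ∃ c : ℕ, ∀ x, 1 ≤ x → P.eval x ≤ c * x ^ c := by
  -- The sum of the coefficients is needed as a factor and the degree as an exponent; for 1 ≤ x
  -- their sum can play both roles.
  refine ⟨(∑ i ∈ Finset.range (P.natDegree + 1), P.coeff i) + P.natDegree, fun x hx => ?_⟩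
  rw [eval_eq_sum_range]
  calc ∑ i ∈ Finset.range (P.natDegree + 1), P.coeff i * x ^ i
      ≤ ∑ i ∈ Finset.range (P.natDegree + 1), P.coeff i * x ^ P.natDegree := by
        refine Finset.sum_le_sum fun i hi => ?_
        have := Finset.mem_range.1 hi
        gcongr
        omega
    _ ≤ _ := by
        rw [← Finset.sum_mul]
        gcongr <;> simp

theorem mul_pow_self_mono {c d x : ℕ} (h : c ≤ d) (hx : 1 ≤ x) : c * x ^ c ≤ d * x ^ d := by
  gcongr

/-! ### Encodings -/

/-- A type whose elements are encoded as data. -/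
class Enc (α : Type) where
  enc : α → Data

open Enc

instance : Enc Unit := ⟨fun _ => .nil⟩
instance : Enc Bool := ⟨encBool⟩
instance : Enc ℕ := ⟨encNat⟩
instance {α : Type} [Enc α] : Enc (List α) := ⟨encList enc⟩
instance {α β : Type} [Enc α] [Enc β] : Enc (α × β) := ⟨fun x => .cons (enc x.1) (enc x.2)⟩
instance {α : Type} [Enc α] : Enc (Option α) :=
  ⟨fun | none => .nil | some a => .cons .nil (enc a)⟩

/-- Literals of formulas, encoded as in `encCnf`. -/
def Lit : Type := ℕ × Bool

/-- The literal saying that the variable `i` has the value `b`. -/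
def Lit.mk (i : ℕ) (b : Bool) : Lit := (i, b)

instance : Enc Lit := ⟨fun l => .cons (encBool l.2) (encNat l.1)⟩

/-- The size of the encoding. -/
def esize {α : Type} [Enc α] (x : α) : ℕ := (enc x).size

theorem Data.size_pos (x : Data) : 1 ≤ x.size := by
  cases x <;> simp only [Data.size] <;> omega

section
variable {α β γ δ : Type} [Enc α] [Enc β] [Enc γ] [Enc δ]

theorem esize_pos (x : α) : 1 ≤ esize x := Data.size_pos _

@[simp] theorem enc_nil : enc ([] : List α) = .nil := rfl
@[simp] theorem enc_cons (a : α) (l : List α) : enc (a :: l) = .cons (enc a) (enc l) := rfl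
@[simp] theorem enc_pair (a : α) (b : β) : enc (a, b) = .cons (enc a) (enc b) := rfl
@[simp] theorem enc_false : enc false = .nil := rfl
@[simp] theorem enc_true : enc true = .cons .nil .nil := rfl
@[simp] theorem enc_succ (k : ℕ) : enc (k + 1) = .cons .nil (enc k) := rfl

theorem esize_pair (a : α) (b : β) : esize (a, b) = 1 + esize a + esize b := rfl
theorem esize_prod (a : α × β) : esize a = 1 + esize a.1 + esize a.2 := rfl
theorem esize_nil : esize ([] : List α) = 1 := rfl
theorem esize_cons (a : α) (l : List α) : esize (a :: l) = 1 + esize a + esize l := rfl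

theorem esize_nat (k : ℕ) : esize k = 2 * k + 1 := by
  induction k with
  | zero => rfl
  | succ k ih =>
    have : esize (k + 1) = 1 + 1 + esize k := rfl
    omega

theorem esize_bool_le (b : Bool) : esize b ≤ 3 := by cases b <;> decide

theorem esize_append (l₁ l₂ : List α) : esize (l₁ ++ l₂) + 1 = esize l₁ + esize l₂ := by
  induction l₁ with
  | nil => simp [esize_nil, add_comm]
  | cons a l ih => simp only [List.cons_append, esize_cons]; omega

theorem esize_reverse (l : List α) : esize l.reverse = esize l := by
  induction l with
  | nil => rfl
  | cons a l ih =>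
    have := esize_append l.reverse [a]
    simp only [List.reverse_cons, esize_cons, esize_nil] at *; omega

theorem esize_list_le {l : List α} {b : ℕ} (h : ∀ a ∈ l, esize a ≤ b) :
    esize l ≤ 1 + l.length * (1 + b) := by
  induction l with
  | nil => simp [esize_nil]
  | cons a l ih =>
    have h1 := h a (by simp)
    have h2 := ih fun c hc => h c (by simp [hc])
    simp only [esize_cons, List.length_cons, add_mul] at *; omega

theorem length_le_esize (l : List α) : l.length ≤ esize l := by
  induction l with
  | nil => simp
  | cons a l ih => simp only [esize_cons, List.length_cons]; omega

theorem esize_le_of_mem {l : List α} {a : α} (h : a ∈ l) : esize a ≤ esize l := by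
  induction l with
  | nil => simp at h
  | cons b l ih =>
    rcases List.mem_cons.1 h with rfl | h
    · simp only [esize_cons]; omega
    · have := ih h; simp only [esize_cons]; omega

theorem esize_drop_le (l : List α) (k : ℕ) : esize (l.drop k) ≤ esize l := by
  have := esize_append (l.take k) (l.drop k)
  rw [List.take_append_drop] at this
  have := esize_pos (l.take k)
  omega

/-! ### Programs -/

/-- Instructions are charged for the data they read and solver calls also for their answers, so a
time bound is always a bound on the size of the output too. -/
theorem Run.size_le {S : SatSolver} {p : Prog} {x y : Data} {t : ℕ} {qs : List Cnf}
    (h : Run S p x y t qs) : y.size ≤ t := by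
  induction h with
  | id x => omega
  | nil x => simp [Data.size]
  | hd x => cases x <;> simp only [Data.size, Data.hd] <;> omega
  | tl x => cases x <;> simp only [Data.size, Data.tl] <;> omega
  | pair _ _ ih₁ ih₂ => simp only [Data.size]; omega
  | _ => omega

/-- The invariant rule for loops: `I k x` says that the datum `x` is admissible when `k` rounds
are left. -/
theorem Run.loop_of_invariant {S : SatSolver} {p : Prog} (I : ℕ → Data → Prop) {T M r Z : ℕ}
    (hsize : ∀ k x, I k x → x.size ≤ M) (hend : ∀ x, I 0 x → x.hd = .nil)
    (hstep : ∀ k x, I (k + 1) x → x.hd ≠ .nil ∧ ∃ y t qs, Run S p x y t qs ∧ t ≤ T ∧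
      qs.length ≤ r ∧ (∀ φ ∈ qs, φ.size ≤ Z) ∧ I k y) (k : ℕ) (x : Data) (hx : I k x) :
    ∃ y t qs, Run S (.loop p) x y t qs ∧ t ≤ (k + 1) * (1 + M + T) ∧ qs.length ≤ r * k ∧
      (∀ φ ∈ qs, φ.size ≤ Z) ∧ I 0 y := by
  induction k generalizing x with
  | zero =>
    refine ⟨x, _, _, .loopStop (hend x hx), ?_, by simp, by simp, hx⟩
    have := hsize _ _ hx
    omega
  | succ k ih =>
    obtain ⟨h, y, t, qs, hr, ht, hl, hq, hy⟩ := hstep k x hx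
    obtain ⟨z, u, qs', hr', ht', hl', hq', hz⟩ := ih y hy
    refine ⟨z, _, _, .loopStep h hr hr', ?_, ?_, ?_, hz⟩
    · have := hsize _ _ hx
      rw [add_mul _ 1, one_mul]; omega
    · rw [List.length_append, Nat.mul_succ]; omega
    · intro φ hφ
      rcases List.mem_append.1 hφ with h | h
      exacts [hq _ h, hq' _ h]

/-! ### Functions computable in polynomial time -/

/-- `f` is computed in polynomial time by a program that does not call the solver. -/
@[fun_prop]
def PT {α β : Type} [Enc α] [Enc β] (f : α → β) : Prop :=
  ∃ (p : Prog) (P : ℕ[X]), ∀ (S : SatSolver) (x : α),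
    ∃ t, Run S p (enc x) (enc (f x)) t [] ∧ t ≤ P.eval (esize x)

/-- `f` is bounded by a polynomial in the size of the argument. -/
def PB {α : Type} [Enc α] (f : α → ℕ) : Prop := ∃ P : ℕ[X], ∀ x, f x ≤ P.eval (esize x)

theorem PB.add {f g : α → ℕ} (hf : PB f) (hg : PB g) : PB fun x => f x + g x := by
  obtain ⟨P, hP⟩ := hf
  obtain ⟨Q, hQ⟩ := hg
  exact ⟨P + Q, fun x => by rw [eval_add]; exact add_le_add (hP x) (hQ x)⟩

theorem PB.mul {f g : α → ℕ} (hf : PB f) (hg : PB g) : PB fun x => f x * g x := by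
  obtain ⟨P, hP⟩ := hf
  obtain ⟨Q, hQ⟩ := hg
  exact ⟨P * Q, fun x => by rw [eval_mul]; exact Nat.mul_le_mul (hP x) (hQ x)⟩

theorem PB.const (c : ℕ) : PB fun _ : α => c := ⟨C c, fun x => by simp⟩

theorem PB.self : PB fun x : α => esize x := ⟨X, fun x => by simp⟩

theorem PB.eval {f : α → ℕ} (hf : PB f) (P : ℕ[X]) : PB fun x => P.eval (f x) := by
  obtain ⟨Q, hQ⟩ := hf
  exact ⟨P.comp Q, fun x => by rw [eval_comp]; exact eval_mono P (hQ x)⟩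

theorem PT.of_bound {f : α → β} {p : Prog} {b : α → ℕ} (hb : PB b)
    (h : ∀ (S : SatSolver) x, ∃ t, Run S p (enc x) (enc (f x)) t [] ∧ t ≤ b x) : PT f := by
  obtain ⟨P, hP⟩ := hb
  exact ⟨p, P, fun S x => (h S x).imp fun t ht => ⟨ht.1, ht.2.trans (hP x)⟩⟩

/-- `PT` quantifies over all solvers, so bounding an output by a running time needs some solver to
exist. -/
theorem exists_satSolver : Nonempty SatSolver := by
  classical
  refine ⟨⟨fun φ => if h : ∃ v, Cnf.Sat v φ then some h.choose else none, ?_, ?_⟩⟩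
  · intro φ v h
    split_ifs at h with h'
    cases h
    exact h'.choose_spec
  · intro φ h v hv
    simp only [dite_eq_right_iff, reduceCtorEq, imp_false] at h
    exact h ⟨v, hv⟩

theorem PT.pb_esize {f : α → β} (hf : PT f) : PB fun x => esize (f x) := by
  obtain ⟨p, P, h⟩ := hf
  refine ⟨P, fun x => ?_⟩
  obtain ⟨S⟩ := exists_satSolver
  obtain ⟨t, ht, hle⟩ := h S x
  exact ht.size_le.trans hle

theorem PT.of_enc_eq {f : α → β} (h : ∀ x, enc (f x) = enc x) : PT f :=
  .of_bound (p := .id) ((PB.const 1).add .self) fun S x => ⟨_, by rw [h]; exact .id _, le_rfl⟩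

@[fun_prop]
theorem PT.id : PT fun x : α => x := .of_enc_eq fun _ => rfl

@[fun_prop]
theorem PT.comp {g : β → γ} {f : α → β} (hg : PT g) (hf : PT f) : PT fun x => g (f x) := by
  have hs := hf.pb_esize
  obtain ⟨q, Q, hq⟩ := hg
  obtain ⟨p, P, hp⟩ := hf
  refine .of_bound (p := .seq p q) ((((PB.const 1).add .self).add (PB.self.eval P)).add
    (hs.eval Q)) fun S x => ?_
  obtain ⟨t, ht, htP⟩ := hp S x
  obtain ⟨u, hu, huQ⟩ := hq S (f x)
  refine ⟨_, .seq ht hu, ?_⟩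
  simp only [esize] at *
  omega

@[fun_prop]
theorem PT.prodMk {f : α → β} {g : α → γ} (hf : PT f) (hg : PT g) :
    PT fun x => (f x, g x) := by
  obtain ⟨p, P, hp⟩ := hf
  obtain ⟨q, Q, hq⟩ := hg
  refine .of_bound (p := .pair p q) ((((PB.const 1).add .self).add (PB.self.eval P)).add
    (PB.self.eval Q)) fun S x => ?_
  obtain ⟨t, ht, htP⟩ := hp S x
  obtain ⟨u, hu, huQ⟩ := hq S x
  refine ⟨_, .pair ht hu, ?_⟩
  simp only [esize] at *
  omega

/-- Programs see only data, so a change of type that keeps the encoding is free. -/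
theorem PT.of_enc_eq_comp {f : α → β} {g : α → γ} (hg : PT g) (h : ∀ x, enc (f x) = enc (g x)) :
    PT f := by
  obtain ⟨p, P, hp⟩ := hg
  exact ⟨p, P, fun S x => by rw [h]; exact hp S x⟩

theorem PT.congr {f g : α → β} (hg : PT g) (h : ∀ x, f x = g x) : PT f :=
  hg.of_enc_eq_comp fun x => by rw [h]

theorem PT.of_hd {f : α → β} (h : ∀ x, enc (f x) = (enc x).hd) : PT f :=
  .of_bound (p := .hd) ((PB.const 1).add .self) fun S x => ⟨_, by rw [h]; exact .hd _, le_rfl⟩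

theorem PT.of_tl {f : α → β} (h : ∀ x, enc (f x) = (enc x).tl) : PT f :=
  .of_bound (p := .tl) ((PB.const 1).add .self) fun S x => ⟨_, by rw [h]; exact .tl _, le_rfl⟩

@[fun_prop]
theorem PT.fst : PT (Prod.fst : α × β → α) := .of_hd fun _ => rfl

@[fun_prop]
theorem PT.snd : PT (Prod.snd : α × β → β) := .of_tl fun _ => rfl

theorem exists_const_prog (d : Data) :
    ∃ (p : Prog) (P : ℕ[X]), ∀ (S : SatSolver) (x : Data),
      ∃ t, Run S p x d t [] ∧ t ≤ P.eval x.size := by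
  induction d with
  | nil => exact ⟨.nil, 1 + X, fun S x => ⟨_, .nil x, by simp⟩⟩
  | cons a b iha ihb =>
    obtain ⟨p, P, hp⟩ := iha
    obtain ⟨q, Q, hq⟩ := ihb
    refine ⟨.pair p q, 1 + X + P + Q, fun S x => ?_⟩
    obtain ⟨t, ht, htP⟩ := hp S x
    obtain ⟨u, hu, huQ⟩ := hq S x
    refine ⟨_, .pair ht hu, ?_⟩
    simp only [eval_add, eval_X, eval_one]
    omega

@[fun_prop]
theorem PT.const (b : β) : PT fun _ : α => b := by
  obtain ⟨p, P, hp⟩ := exists_const_prog (enc b)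
  exact ⟨p, P, fun S x => hp S (enc x)⟩

/-- Case distinction by a test on the head of the datum. -/
theorem PT.of_cond {f g h : α → β} (hf : PT f) (hg : PT g)
    (hh : ∀ x, ((enc x).hd ≠ .nil → h x = f x) ∧ ((enc x).hd = .nil → h x = g x)) : PT h := by
  obtain ⟨p, P, hp⟩ := hf
  obtain ⟨q, Q, hq⟩ := hg
  refine .of_bound (p := .cond p q) ((((PB.const 1).add .self).add (PB.self.eval P)).add
    (PB.self.eval Q)) fun S x => ?_
  obtain ⟨t, ht, htP⟩ := hp S x
  obtain ⟨u, hu, huQ⟩ := hq S x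
  by_cases hx : (enc x).hd = .nil
  · rw [(hh x).2 hx]
    refine ⟨_, .condFalse hx hu, ?_⟩
    simp only [esize] at *
    omega
  · rw [(hh x).1 hx]
    refine ⟨_, .condTrue hx ht, ?_⟩
    simp only [esize] at *
    omega

@[fun_prop]
theorem PT.cond {c : α → Bool} {f g : α → β} (hc : PT c) (hf : PT f) (hg : PT g) :
    PT fun x => bif c x then f x else g x := by
  have key : PT fun y : Bool × α => bif y.1 then f y.2 else g y.2 := by
    refine .of_cond (hf.comp .snd) (hg.comp .snd) ?_
    rintro ⟨b, x⟩
    cases b <;> simp [Data.hd]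
  exact key.comp (hc.prodMk .id)

@[fun_prop]
theorem PT.not {c : α → Bool} (hc : PT c) : PT fun x => !c x :=
  (hc.cond (.const false) (.const true)).congr fun x => by cases c x <;> rfl

@[fun_prop]
theorem PT.or {c d : α → Bool} (hc : PT c) (hd : PT d) : PT fun x => c x || d x :=
  (hc.cond (.const true) hd).congr fun x => by cases c x <;> rfl

/-! ### Lists -/

@[fun_prop]
theorem PT.cons {f : α → β} {g : α → List β} (hf : PT f) (hg : PT g) :
    PT fun x => f x :: g x :=
  (hf.prodMk hg).of_enc_eq_comp fun _ => rfl

@[fun_prop]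
theorem PT.tail : PT (List.tail : List α → List α) :=
  .of_tl fun l => by cases l <;> rfl

@[fun_prop]
theorem PT.isEmpty {f : α → List β} (hf : PT f) : PT fun x => (f x).isEmpty := by
  -- The test inspects the head of a datum; pairing with a dummy puts the list there.
  have key : PT fun y : List β × Unit => y.1.isEmpty := by
    refine .of_cond (.const false) (.const true) ?_
    rintro ⟨l, _⟩
    cases l <;> simp [Data.hd]
  exact key.comp (hf.prodMk (.const ()))

@[fun_prop]
theorem PT.headD {f : α → List β} {g : α → β} (hf : PT f) (hg : PT g) :
    PT fun x => (f x).headD (g x) := by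
  have hhd : PT fun y : List β × β => y.1.headD y.2 := by
    refine .of_bound (p := .cond (.seq .hd .hd) .tl)
      ((PB.const 5).add ((PB.const 5).mul .self)) fun S x => ?_
    obtain ⟨l, d⟩ := x
    cases l with
    | nil =>
      refine ⟨_, .condFalse rfl (.tl _), ?_⟩
      simp only [esize]; omega
    | cons a l =>
      refine ⟨_, .condTrue (by simp [Data.hd]) (.seq (.hd _) (.hd _)), ?_⟩
      simp only [esize, enc_pair, enc_cons, Data.hd, Data.size]; omega
  exact hhd.comp (hf.prodMk hg)

/-- Iterating a polynomial-time function can produce exponentially large values, hence the required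
bound on every intermediate accumulator. The loop carries the remaining list, the accumulator and
the parameter; its test succeeds exactly while the list is nonempty. -/
theorem PT.foldl_of_bound {l : α → List γ} {i : α → β} {s : α → β → γ → β} (hl : PT l)
    (hi : PT i) (hs : PT fun p : α × β × γ => s p.1 p.2.1 p.2.2) {b : α → ℕ} (hb : PB b)
    (h : ∀ x l₁, l₁ <+: l x → esize (l₁.foldl (s x) (i x)) ≤ b x) :
    PT fun x => (l x).foldl (s x) (i x) := by
  have hbody : PT fun y : (γ × List γ) × β × α => (y.1.2, s y.2.2 y.2.1 y.1.1, y.2.2) :=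
    (PT.snd.comp .fst).prodMk
      ((hs.comp ((PT.snd.comp .snd).prodMk ((PT.fst.comp .snd).prodMk (PT.fst.comp .fst)))).prodMk
        (PT.snd.comp .snd))
  obtain ⟨p, P, hp⟩ := hbody
  have hloop : ∃ t : α → ℕ, PB t ∧ ∀ (S : SatSolver) x, ∃ u,
      Run S (.loop p) (enc (l x, i x, x))
        (enc (([] : List γ), (l x).foldl (s x) (i x), x)) u [] ∧ u ≤ t x := by
    have hM : PB fun x => 2 + esize (l x) + b x + esize x :=
      (((PB.const 2).add hl.pb_esize).add hb).add .self
    refine ⟨fun x => (esize (l x) + 1) *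
      (1 + (2 + esize (l x) + b x + esize x) +
        P.eval (2 + esize (l x) + b x + esize x)),
      (hl.pb_esize.add (.const 1)).mul (((PB.const 1).add hM).add (hM.eval P)), fun S x => ?_⟩
    have hbd : ∀ l₁ l₂, l₁ ++ l₂ = l x →
        esize (l₂, l₁.foldl (s x) (i x), x) ≤
          2 + esize (l x) + b x + esize x := by
      intro l₁ l₂ h12
      have h1 := h x l₁ ⟨l₂, h12⟩
      have h2 := esize_append l₁ l₂
      have := esize_pos l₁
      rw [h12] at h2
      simp only [esize_pair]; omega
    obtain ⟨y, u, qs, hrun, hu, hq, -, l₁, l₂, h12, hlen, rfl⟩ :=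
      Run.loop_of_invariant (S := S) (p := p)
        (fun k d => ∃ l₁ l₂, l₁ ++ l₂ = l x ∧ l₂.length = k ∧
          d = enc (l₂, l₁.foldl (s x) (i x), x))
        (T := P.eval (2 + esize (l x) + b x + esize x))
        (M := 2 + esize (l x) + b x + esize x) (r := 0) (Z := 0)
        (by
          rintro k d ⟨l₁, l₂, h12, -, rfl⟩
          exact hbd l₁ l₂ h12)
        (by
          rintro d ⟨l₁, l₂, h12, hlen, rfl⟩
          rw [List.length_eq_zero_iff] at hlen
          subst hlen
          rfl)
        (by
          rintro k d ⟨l₁, l₂, h12, hlen, rfl⟩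
          obtain _ | ⟨a, l₂⟩ := l₂
          · simp at hlen
          refine ⟨by simp [Data.hd], ?_⟩
          obtain ⟨t, ht, htP⟩ := hp S ((a, l₂), l₁.foldl (s x) (i x), x)
          refine ⟨_, t, _, ht, htP.trans (eval_mono P (hbd l₁ (a :: l₂) h12)), by simp, by simp,
            l₁ ++ [a], l₂, by simpa using h12, by simpa using hlen, ?_⟩
          simp)
        (l x).length (enc (l x, i x, x)) ⟨[], l x, rfl, rfl, rfl⟩
    rw [List.length_eq_zero_iff] at hlen
    subst hlen
    rw [List.append_nil] at h12
    subst h12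
    have hq0 : qs = [] := by simpa using hq
    subst hq0
    exact ⟨u, hrun, hu.trans (Nat.mul_le_mul_right _ (Nat.succ_le_succ (length_le_esize _)))⟩
  obtain ⟨t, ht, hrun⟩ := hloop
  have hset : PT fun x => (l x, i x, x) := hl.prodMk (hi.prodMk .id)
  have hset' := hset
  obtain ⟨q, Q, hq⟩ := hset'
  have hres : PB fun x => 1 + esize x + Q.eval (esize x) +
      (1 + esize (l x, i x, x) + t x + (1 + t x + (1 + t x) + (1 + t x))) :=
    (((PB.const 1).add .self).add (PB.self.eval Q)).add
      ((((PB.const 1).add hset.pb_esize).add ht).add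
        ((((PB.const 1).add ht).add ((PB.const 1).add ht)).add ((PB.const 1).add ht)))
  refine .of_bound (p := .seq q (.seq (.loop p) (.seq .tl .hd))) hres fun S x => ?_
  obtain ⟨u, hu, huQ⟩ := hq S x
  obtain ⟨v, hv, hvt⟩ := hrun S x
  refine ⟨_, .seq hu (.seq hv (.seq (.tl _) (.hd _))), ?_⟩
  have h1 := hv.size_le
  have h2 : (enc (([] : List γ), (l x).foldl (s x) (i x), x)).tl.size ≤
      (enc (([] : List γ), (l x).foldl (s x) (i x), x)).size := by
    simp only [enc_pair, Data.tl, Data.size]; omega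
  simp only [esize] at *
  omega

/-- Folding with an invariant `I` that bounds the size of the accumulator. -/
theorem PT.foldl_of_invariant {l : α → List γ} {i : α → β} {s : α → β → γ → β} (hl : PT l)
    (hi : PT i) (hs : PT fun p : α × β × γ => s p.1 p.2.1 p.2.2) {b : α → ℕ} (hb : PB b)
    (I : α → β → Prop) (h0 : ∀ x, I x (i x)) (h1 : ∀ x y c, I x y → I x (s x y c))
    (h : ∀ x y, I x y → esize y ≤ b x) :
    PT fun x => (l x).foldl (s x) (i x) := by
  refine hl.foldl_of_bound hi hs hb fun x l₁ hl₁ => h _ _ ?_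
  clear hl₁
  induction l₁ using List.reverseRecOn with
  | nil => exact h0 x
  | append_singleton l₁ a ih => rw [List.foldl_append]; exact h1 _ _ _ ih

theorem foldl_cons_eq {α : Type} (l₁ l₂ : List α) :
    l₁.foldl (fun acc a => a :: acc) l₂ = l₁.reverse ++ l₂ := by
  induction l₁ generalizing l₂ with
  | nil => rfl
  | cons a l ih => simp [ih]

@[fun_prop]
theorem PT.reverse {f : α → List β} (hf : PT f) : PT fun x => (f x).reverse := by
  have h : PT fun x => (f x).foldl (fun acc a => a :: acc) [] := by
    refine hf.foldl_of_bound (.const []) (by fun_prop) hf.pb_esize fun x l₁ hl => ?_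
    rw [foldl_cons_eq, List.append_nil, esize_reverse]
    obtain ⟨l₂, h⟩ := hl
    have := esize_append l₁ l₂
    have := esize_pos l₂
    rw [h] at *
    omega
  exact h.congr fun x => by simp

@[fun_prop]
theorem PT.append {f g : α → List β} (hf : PT f) (hg : PT g) : PT fun x => f x ++ g x := by
  have h : PT fun x => (f x).reverse.foldl (fun acc a => a :: acc) (g x) := by
    refine hf.reverse.foldl_of_bound hg (by fun_prop) (hf.pb_esize.add hg.pb_esize) fun x l₁ hl => ?_
    rw [foldl_cons_eq]
    obtain ⟨l₂, h⟩ := hl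
    have h1 := esize_append l₁ l₂
    have h2 := esize_append l₁.reverse (g x)
    have := esize_pos l₂
    rw [h] at *
    rw [esize_reverse] at *
    omega
  exact h.congr fun x => by simp

theorem foldl_append_eq_flatMap {α β : Type} (f : α → List β) (l : List α) (acc : List β) :
    l.foldl (fun acc a => acc ++ f a) acc = acc ++ l.flatMap f := by
  induction l generalizing acc with
  | nil => simp
  | cons a l ih => simp [ih]

theorem esize_flatMap_le {γ : Type} {f : γ → List β} {l : List γ} {b : ℕ} (h : ∀ a ∈ l, esize (f a) ≤ b) :
    esize (l.flatMap f) ≤ 1 + l.length * b := by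
  induction l with
  | nil => simp [esize_nil]
  | cons a l ih =>
    have h1 := h a (by simp)
    have h2 := ih fun c hc => h c (by simp [hc])
    have h3 := esize_append (f a) (l.flatMap f)
    simp only [List.flatMap_cons, List.length_cons, add_mul] at *; omega

@[fun_prop]
theorem PT.flatMap {l : α → List γ} {f : α → γ → List β} (hl : PT l)
    (hf : PT fun p : α × γ => f p.1 p.2) : PT fun x => (l x).flatMap (fun a => f x a) := by
  obtain ⟨P, hP⟩ := hf.pb_esize
  have hb : PB fun x => 1 + esize (l x) *
      P.eval (1 + esize x + esize (l x)) :=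
    (PB.const 1).add (hl.pb_esize.mul ((((PB.const 1).add .self).add hl.pb_esize).eval P))
  have h : PT fun x => (l x).foldl (fun acc a => acc ++ f x a) [] := by
    refine hl.foldl_of_bound (.const []) ?_ hb fun x l₁ h1 => ?_
    · exact (PT.fst.comp .snd).append
        (hf.comp (PT.fst.prodMk (PT.snd.comp .snd)))
    · rw [foldl_append_eq_flatMap, List.nil_append]
      refine (esize_flatMap_le (b := P.eval (1 + esize x + esize (l x)))
        fun a ha => ?_).trans ?_
      · refine (hP (x, a)).trans (eval_mono P ?_)
        rw [esize_pair]
        have := esize_le_of_mem (h1.subset ha)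
        omega
      · gcongr
        exact h1.length_le.trans (length_le_esize _)
  exact h.congr fun x => by rw [foldl_append_eq_flatMap, List.nil_append]

@[fun_prop]
theorem PT.map {l : α → List γ} {f : α → γ → β} (hl : PT l)
    (hf : PT fun p : α × γ => f p.1 p.2) : PT fun x => (l x).map (fun a => f x a) :=
  (hl.flatMap (f := fun x a => [f x a]) (hf.cons (.const []))).congr fun x => by
    rw [List.map_eq_flatMap]

/-! ### Natural numbers -/

/-- A unary number is the same datum as a list of units. Arithmetic thus reduces to list operations:
addition is `append`, multiplication is `flatMap`. -/
theorem enc_list_unit (l : List Unit) : enc l = enc l.length := by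
  induction l with
  | nil => rfl
  | cons a l ih => rw [List.length_cons, enc_cons, enc_succ, ih]; rfl

theorem PT.length_unit {f : α → List Unit} (hf : PT f) : PT fun x => (f x).length :=
  hf.of_enc_eq_comp fun _ => (enc_list_unit _).symm

@[fun_prop]
theorem PT.units {f : α → ℕ} (hf : PT f) : PT fun x => List.replicate (f x) () :=
  hf.of_enc_eq_comp fun x => by rw [enc_list_unit, List.length_replicate]

@[fun_prop]
theorem PT.length {f : α → List β} (hf : PT f) : PT fun x => (f x).length :=
  (hf.map (f := fun _ _ => ()) (.const ())).length_unit.congr fun x => by simp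

@[fun_prop]
theorem PT.add {f g : α → ℕ} (hf : PT f) (hg : PT g) : PT fun x => f x + g x :=
  (hf.units.append hg.units).length_unit.congr fun x => by simp

@[fun_prop]
theorem PT.mul {f g : α → ℕ} (hf : PT f) (hg : PT g) : PT fun x => f x * g x :=
  (hf.units.flatMap (f := fun x _ => List.replicate (g x) ())
    (hg.comp .fst).units).length_unit.congr fun x => by simp

theorem PT.pred : PT fun k : ℕ => k - 1 := .of_tl fun k => by cases k <;> rfl

theorem foldl_units {β : Type} (f : β → β) (b : β) (k : ℕ) :
    (List.replicate k ()).foldl (fun y _ => f y) b = f^[k] b := by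
  induction k generalizing b with
  | zero => rfl
  | succ k ih => rw [List.replicate_succ, List.foldl_cons, ih]; rfl

@[fun_prop]
theorem PT.sub {f g : α → ℕ} (hf : PT f) (hg : PT g) : PT fun x => f x - g x := by
  have h : PT fun x => (List.replicate (g x) ()).foldl (fun k _ => k - 1) (f x) :=
    hg.units.foldl_of_invariant hf (PT.pred.comp (.comp .fst .snd)) hf.pb_esize
      (fun x k => k ≤ f x) (fun _ => le_rfl) (fun _ _ _ h => (Nat.sub_le _ _).trans h)
      (fun x y h => by rw [esize_nat, esize_nat]; omega)
  refine h.congr fun x => ?_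
  rw [foldl_units (fun k => k - 1)]
  induction g x with
  | zero => rfl
  | succ k ih => rw [Function.iterate_succ_apply', ← ih]; omega

@[fun_prop]
theorem PT.drop {f : α → List β} {g : α → ℕ} (hf : PT f) (hg : PT g) :
    PT fun x => (f x).drop (g x) := by
  have h : PT fun x => (List.replicate (g x) ()).foldl (fun l _ => l.tail) (f x) :=
    hg.units.foldl_of_invariant hf (PT.tail.comp (.comp .fst .snd)) hf.pb_esize
      (fun x l => esize l ≤ esize (f x)) (fun _ => le_rfl)
      (fun _ l _ h => by
        rw [← List.drop_one]
        exact (esize_drop_le _ _).trans h)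
      (fun x y h => h)
  refine h.congr fun x => ?_
  rw [foldl_units List.tail]
  induction g x with
  | zero => rfl
  | succ k ih => rw [Function.iterate_succ_apply', ← ih, List.tail_drop]

@[fun_prop]
theorem PT.getD {f : α → List β} {g : α → ℕ} {d : α → β} (hf : PT f) (hg : PT g) (hd : PT d) :
    PT fun x => (f x).getD (g x) (d x) :=
  ((hf.drop hg).headD hd).congr fun x => by simp [List.headD_eq_head?_getD, List.head?_drop]

@[fun_prop]
theorem PT.decide_lt {f g : α → ℕ} (hf : PT f) (hg : PT g) : PT fun x => decide (f x < g x) :=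
  (hg.sub hf).units.isEmpty.not.congr fun x => by
    rw [Bool.eq_iff_iff]
    simp [Nat.sub_eq_zero_iff_le]

@[fun_prop]
theorem PT.natPair {f g : α → ℕ} (hf : PT f) (hg : PT g) : PT fun x => Nat.pair (f x) (g x) :=
  ((hf.decide_lt hg).cond ((hg.mul hg).add hf) (((hf.mul hf).add hf).add hg)).congr fun x => by
    simp [Nat.pair, Bool.cond_decide]

theorem iterate_range (k : ℕ) : (fun l : List ℕ => l ++ [l.length])^[k] [] = List.range k := by
  induction k with
  | zero => rfl
  | succ k ih => rw [Function.iterate_succ_apply', ih, List.range_succ, List.length_range]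

@[fun_prop]
theorem PT.range {f : α → ℕ} (hf : PT f) : PT fun x => List.range (f x) := by
  have h : PT fun x => (List.replicate (f x) ()).foldl (fun l _ => l ++ [l.length]) [] := by
    refine hf.units.foldl_of_bound (.const []) (by fun_prop)
      (b := fun x => 1 + esize (f x) * (1 + esize (f x)))
      ((PB.const 1).add (hf.pb_esize.mul ((PB.const 1).add hf.pb_esize))) fun x l₁ h => ?_
    obtain ⟨hle, hl₁⟩ := List.prefix_replicate_iff.1 h
    rw [hl₁]
    generalize l₁.length = k at hle
    rw [foldl_units (fun l : List ℕ => l ++ [l.length]), iterate_range]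
    refine (esize_list_le (b := esize (f x)) fun a ha => ?_).trans ?_
    · rw [List.mem_range] at ha
      rw [esize_nat, esize_nat]; omega
    · rw [List.length_range]
      gcongr
      rw [esize_nat]; omega
  exact h.congr fun x => by rw [foldl_units (fun l : List ℕ => l ++ [l.length]), iterate_range]

@[fun_prop]
theorem PT.lit {f : α → ℕ} {g : α → Bool} (hf : PT f) (hg : PT g) :
    PT fun x => Lit.mk (f x) (g x) :=
  (hg.prodMk hf).of_enc_eq_comp fun _ => rfl

@[fun_prop]
theorem PT.option_getD {f : α → Option (List β)} (hf : PT f) : PT fun x => (f x).getD [] := by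
  have : PT fun o : Option (List β) => o.getD [] := .of_tl fun o => by cases o <;> rfl
  exact this.comp hf

@[fun_prop]
theorem PT.isSome {f : α → Option β} (hf : PT f) : PT fun x => (f x).isSome := by
  have key : PT fun y : Option β × Unit => y.1.isSome := by
    refine .of_cond (.const true) (.const false) ?_
    rintro ⟨o, _⟩
    cases o with
    | none => simp [Data.hd, enc]
    | some a => simp [Data.hd, enc]
  exact key.comp (hf.prodMk (.const ()))

end

end DFALearning

namespace DFALearning

open Enc

/-! ### The formulas -/

/-- The variable saying that the letter `a` leads from the state `q` to the state `s`. -/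
def varStep (q a s : ℕ) : ℕ := Nat.pair 0 (Nat.pair q (Nat.pair a s))

/-- The variable saying that the state `q` is not final. -/
def varReject (q : ℕ) : ℕ := Nat.pair 1 q

/-- The variable for the bit `j` of the number of words of length less than `i` that are accepted
from `q` and are empty (if `0 < i`) or start with a letter less than `a`. -/
def varSum (i q a j : ℕ) : ℕ := Nat.pair 2 (Nat.pair i (Nat.pair q (Nat.pair a j)))

/-- The variable for the carry into the bit `j` in the addition that computes the number with the
variables `varSum (i + 1) q (a + 1)`. -/
def varCarry (i q a j : ℕ) : ℕ := Nat.pair 3 (Nat.pair i (Nat.pair q (Nat.pair a j)))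

/-- The variable saying that the first `j` letters of the word `i` lead to the state `q`. -/
def varReach (i j q : ℕ) : ℕ := Nat.pair 4 (Nat.pair i (Nat.pair j q))

/-- The correct columns of a binary addition: `x`, `y` and the carry `c` add up to the digit `z`
and the carry `d`. -/
def FullAdder (x y c z d : Bool) : Prop :=
  2 * d.toNat + z.toNat = x.toNat + y.toNat + c.toNat

instance (x y c z d : Bool) : Decidable (FullAdder x y c z d) :=
  inferInstanceAs (Decidable (_ = _))

/-- The incorrect columns of a binary addition. -/
def badColumns : List (Bool × Bool × Bool × Bool × Bool) :=
  ([false, true] ×ˢ [false, true] ×ˢ [false, true] ×ˢ [false, true] ×ˢ [false, true]).filter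
    fun t => !decide (FullAdder t.1 t.2.1 t.2.2.1 t.2.2.2.1 t.2.2.2.2)

theorem mem_badColumns (x y c z d : Bool) :
    (x, y, c, z, d) ∈ badColumns ↔ ¬ FullAdder x y c z d := by
  revert x y c z d
  decide

/-- Every letter leads from every state to some state. -/
def stepClauses (m n : ℕ) : List (List Lit) :=
  (List.range n).flatMap fun q => (List.range m).map fun a =>
    (List.range n).map fun q' => Lit.mk (varStep q a q') true

/-- The words of `l` are accepted from the state `0`. -/
def wordClauses (n : ℕ) (l : List (List ℕ)) : List (List Lit) :=
  (List.range l.length).flatMap fun i =>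
    [Lit.mk (varReach i 0 0) true] ::
      (((List.range (l.getD i []).length).flatMap fun j => (List.range n).flatMap fun q =>
          (List.range n).map fun q' =>
            [Lit.mk (varReach i j q) false, Lit.mk (varStep q ((l.getD i []).getD j 0) q') false,
              Lit.mk (varReach i (j + 1) q') true]) ++
        (List.range n).map fun q =>
          [Lit.mk (varReach i (l.getD i []).length q) false, Lit.mk (varReject q) false])

/-- There is no word of length less than `0`. -/
def zeroClauses (m n b : ℕ) : List (List Lit) :=
  (List.range n).flatMap fun q => (List.range b).map fun j => [Lit.mk (varSum 0 q m j) false]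

/-- The summation over the letters starts with the contribution of the empty word. -/
def finalClauses (n r b : ℕ) : List (List Lit) :=
  (List.range r).flatMap fun i => (List.range n).flatMap fun q =>
    [Lit.mk (varSum (i + 1) q 0 0) true, Lit.mk (varReject q) true] ::
      [Lit.mk (varSum (i + 1) q 0 0) false, Lit.mk (varReject q) false] ::
        (List.range (b - 1)).map fun j => [Lit.mk (varSum (i + 1) q 0 (j + 1)) false]

/-- The additions start without a carry, and do not overflow. -/
def carryClauses (m n r b : ℕ) : List (List Lit) :=
  (List.range r).flatMap fun i => (List.range n).flatMap fun q => (List.range m).flatMap fun a =>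
    [[Lit.mk (varCarry i q a 0) false], [Lit.mk (varCarry i q a b) false]]

/-- Each summand is the number of accepted words of length less than `i` from the next state. -/
def adderClauses (m n r b : ℕ) : List (List Lit) :=
  (List.range r).flatMap fun i => (List.range n).flatMap fun q => (List.range m).flatMap fun a =>
    (List.range n).flatMap fun q' => (List.range b).flatMap fun j => badColumns.map fun t =>
      [Lit.mk (varStep q a q') false, Lit.mk (varSum (i + 1) q a j) (!t.1),
        Lit.mk (varSum i q' m j) (!t.2.1), Lit.mk (varCarry i q a j) (!t.2.2.1),
        Lit.mk (varSum (i + 1) q (a + 1) j) (!t.2.2.2.1),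
        Lit.mk (varCarry i q a (j + 1)) (!t.2.2.2.2)]

/-- The bits `k, k + 1, …` of the number of accepted words of length less than `r` are the elements
of `p`. -/
def bitClauses (m r k : ℕ) (p : List Bool) : List (List Lit) :=
  (List.range p.length).map fun i => [Lit.mk (varSum r 0 m (k + i)) (p.getD i false)]

/-- The formula saying that there is an automaton with at most `n` states which accepts the words
of `l` such that the bits `k, k + 1, …` of the number of accepted words of length less than `r`
are the elements of `p`. -/
def formula (m n r b : ℕ) (l : List (List ℕ)) (k : ℕ) (p : List Bool) : List (List Lit) :=
  stepClauses m n ++ (wordClauses n l ++ (zeroClauses m n b ++ (finalClauses n r b ++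
    (carryClauses m n r b ++ (adderClauses m n r b ++ bitClauses m r k p)))))

/-! ### The formulas can be written in polynomial time -/

section
variable {α : Type} [Enc α] {f g h i j k : α → ℕ}

@[fun_prop]
theorem PT.varStep (hf : PT f) (hg : PT g) (hh : PT h) :
    PT fun x => varStep (f x) (g x) (h x) := by
  unfold DFALearning.varStep; fun_prop

@[fun_prop]
theorem PT.varReject (hf : PT f) : PT fun x => varReject (f x) := by
  unfold DFALearning.varReject; fun_prop

@[fun_prop]
theorem PT.varSum (hf : PT f) (hg : PT g) (hh : PT h) (hi : PT i) :
    PT fun x => varSum (f x) (g x) (h x) (i x) := by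
  unfold DFALearning.varSum; fun_prop

@[fun_prop]
theorem PT.varCarry (hf : PT f) (hg : PT g) (hh : PT h) (hi : PT i) :
    PT fun x => varCarry (f x) (g x) (h x) (i x) := by
  unfold DFALearning.varCarry; fun_prop

@[fun_prop]
theorem PT.varReach (hf : PT f) (hg : PT g) (hh : PT h) :
    PT fun x => varReach (f x) (g x) (h x) := by
  unfold DFALearning.varReach; fun_prop

@[fun_prop]
theorem PT.stepClauses (hf : PT f) (hg : PT g) : PT fun x => stepClauses (f x) (g x) := by
  unfold DFALearning.stepClauses; fun_prop

@[fun_prop]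
theorem PT.wordClauses {l : α → List (List ℕ)} (hf : PT f) (hl : PT l) :
    PT fun x => wordClauses (f x) (l x) := by
  unfold DFALearning.wordClauses; fun_prop

@[fun_prop]
theorem PT.zeroClauses (hf : PT f) (hg : PT g) (hh : PT h) :
    PT fun x => zeroClauses (f x) (g x) (h x) := by
  unfold DFALearning.zeroClauses; fun_prop

@[fun_prop]
theorem PT.finalClauses (hf : PT f) (hg : PT g) (hh : PT h) :
    PT fun x => finalClauses (f x) (g x) (h x) := by
  unfold DFALearning.finalClauses; fun_prop

@[fun_prop]
theorem PT.carryClauses (hf : PT f) (hg : PT g) (hh : PT h) (hi : PT i) :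
    PT fun x => carryClauses (f x) (g x) (h x) (i x) := by
  unfold DFALearning.carryClauses; fun_prop

@[fun_prop]
theorem PT.adderClauses (hf : PT f) (hg : PT g) (hh : PT h) (hi : PT i) :
    PT fun x => adderClauses (f x) (g x) (h x) (i x) := by
  unfold DFALearning.adderClauses; fun_prop

@[fun_prop]
theorem PT.bitClauses {p : α → List Bool} (hf : PT f) (hg : PT g) (hh : PT h) (hp : PT p) :
    PT fun x => bitClauses (f x) (g x) (h x) (p x) := by
  unfold DFALearning.bitClauses; fun_prop

@[fun_prop]
theorem PT.formula {l : α → List (List ℕ)} {p : α → List Bool} (hf : PT f) (hg : PT g)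
    (hh : PT h) (hi : PT i) (hl : PT l) (hj : PT j) (hp : PT p) :
    PT fun x => formula (f x) (g x) (h x) (i x) (l x) (j x) (p x) := by
  unfold DFALearning.formula; fun_prop

end
end DFALearning

namespace DFALearning

open Enc

/-! ### The number of bits of a geometric sum -/

/-- The sum of the first `r` powers of `m`, which is the number of words of length less than `r`
over an alphabet with `m` letters. -/
def geomSum (m : ℕ) : ℕ → ℕ
  | 0 => 0
  | r + 1 => 1 + m * geomSum m r

/-- The binary digits of `x` of index less than `w`, least significant digit first. -/
def bits (w x : ℕ) : List Bool := (List.range w).map fun j => x.testBit j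

theorem bits_succ (w x : ℕ) : bits (w + 1) x = bits w x ++ [x.testBit w] := by
  simp [bits, List.range_succ]

theorem bits_succ' (w x : ℕ) : bits (w + 1) x = x.testBit 0 :: bits w (x / 2) := by
  simp [bits, List.range_succ_eq_map, Nat.testBit_div_two]

/-- One digit of the multiplication of a binary number by `m`; the carry is in unary. -/
def mulStep (m : ℕ) (s : ℕ × List Bool) (b : Bool) : ℕ × List Bool :=
  ((s.1 + bif b then m else 0) / 2,
    decide (0 < (s.1 + bif b then m else 0) - 2 * ((s.1 + bif b then m else 0) / 2)) :: s.2)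

/-- The digits of `1 + m * x` if `l` are those of `x`, with the same number of digits. -/
def mulSucc (m : ℕ) (l : List Bool) : List Bool := (l.foldl (mulStep m) (1, [])).2.reverse

/-- Schoolbook multiplication: after w digits, the carry is what the digits of `x` read so far
contribute above the lowest w bits of the result. -/
theorem foldl_mulStep (m c w x : ℕ) : (bits w x).foldl (mulStep m) (c, []) =
    ((c + m * (x % 2 ^ w)) / 2 ^ w, (bits w (c + m * x)).reverse) := by
  induction w with
  | zero => simp [bits, Nat.mod_one]
  | succ w ih =>
    rw [bits_succ, List.foldl_append, ih, bits_succ, List.reverse_append]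
    simp only [List.foldl_cons, List.foldl_nil, mulStep, List.reverse_singleton,
      List.singleton_append, Prod.mk.injEq, List.cons.injEq, and_true]
    have h2 : 0 < 2 ^ w := by positivity
    have hb : (bif x.testBit w then m else 0) = m * (x / 2 ^ w % 2) := by
      rw [Nat.testBit_eq_decide_div_mod_eq]
      rcases Nat.mod_two_eq_zero_or_one (x / 2 ^ w) with h | h <;> simp [h]
    have hv : (c + m * (x % 2 ^ w)) / 2 ^ w + m * (x / 2 ^ w % 2) =
        (c + m * (x % 2 ^ (w + 1))) / 2 ^ w := by
      rw [← Nat.add_mul_div_left _ _ h2, Nat.mod_pow_succ]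
      congr 1; ring
    rw [hb, hv, Nat.div_div_eq_div_mul, ← pow_succ]
    refine ⟨rfl, ?_⟩
    -- Dropping the digits of `x` from index w + 1 on changes the sum by a multiple of 2^(w + 1),
    -- which leaves bit w alone.
    have hm : (c + m * x) / 2 ^ w % 2 = (c + m * (x % 2 ^ (w + 1))) / 2 ^ w % 2 := by
      conv_lhs => rw [← Nat.mod_add_div x (2 ^ (w + 1))]
      rw [mul_add, ← add_assoc, show m * (2 ^ (w + 1) * (x / 2 ^ (w + 1))) =
        2 ^ w * (2 * (m * (x / 2 ^ (w + 1)))) by rw [pow_succ]; ring, Nat.add_mul_div_left _ _ h2,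
        Nat.add_mul_mod_self_left]
    rw [Nat.testBit_eq_decide_div_mod_eq, hm, pow_succ, ← Nat.div_div_eq_div_mul]
    congr 1
    rw [eq_iff_iff]
    omega

theorem mulSucc_bits (m w x : ℕ) : mulSucc m (bits w x) = bits w (1 + m * x) := by
  rw [mulSucc, foldl_mulStep, List.reverse_reverse]

/-- The number of digits of a binary number given by its digits, most significant digit first. -/
def numDigits (l : List Bool) : ℕ :=
  l.foldl (fun k b => bif b || decide (0 < k) then k + 1 else 0) 0

theorem numDigits_bits {w x : ℕ} (h : x < 2 ^ w) : numDigits (bits w x).reverse = x.size := by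
  induction w generalizing x with
  | zero =>
    obtain rfl : x = 0 := by simpa using h
    rfl
  | succ w ih =>
    rw [bits_succ', List.reverse_cons, numDigits, List.foldl_append, ← numDigits,
      ih (by rw [pow_succ] at h; omega)]
    simp only [List.foldl_cons, List.foldl_nil]
    rcases Nat.eq_zero_or_pos x with rfl | hx
    · rfl
    · have h1 : x.size = (x / 2).size + 1 := by
        conv_lhs => rw [← Nat.bit_bodd_div2 x]
        rw [Nat.size_bit (by rw [Nat.bit_bodd_div2]; omega), Nat.div2_val]
      rw [h1]
      cases hb : x.testBit 0 with
      | true => simp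
      | false =>
        have : 0 < (x / 2).size := by
          rw [Nat.size_pos]
          simp at hb
          omega
        simp [this]

/-- The number of binary digits of `geomSum m r`. -/
def geomSize (m r : ℕ) : ℕ :=
  numDigits ((List.replicate r ()).foldl (fun l _ => mulSucc m l)
    ((List.range (m * r)).map fun _ => false)).reverse

/-- A crude but polynomial width, in which the repeated multiplication loses no digit. -/
theorem geomSum_lt (m r : ℕ) (hm : 1 ≤ m) : geomSum m r < 2 ^ (m * r) := by
  induction r with
  | zero => simp [geomSum]
  | succ r ih =>
    have h1 : m + 1 ≤ 2 ^ m := Nat.lt_two_pow_self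
    have h2 : 1 ≤ 2 ^ (m * r) := Nat.one_le_two_pow
    have h3 : (m + 1) * 2 ^ (m * r) ≤ 2 ^ m * 2 ^ (m * r) := Nat.mul_le_mul_right _ h1
    have h4 : m * (geomSum m r + 1) ≤ m * 2 ^ (m * r) := Nat.mul_le_mul_left _ ih
    rw [geomSum, mul_add m r, pow_add, mul_one, mul_comm (2 ^ (m * r))]
    nlinarith

theorem geomSize_eq {m r : ℕ} (hm : 1 ≤ m) : geomSize m r = (geomSum m r).size := by
  have h : ∀ k, (fun l => mulSucc m l)^[k] ((List.range (m * r)).map fun _ => false) =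
      bits (m * r) (geomSum m k) := by
    intro k
    induction k with
    | zero => simp [bits, geomSum]
    | succ k ih => rw [Function.iterate_succ_apply', ih, mulSucc_bits, geomSum]
  rw [geomSize, foldl_units (fun l => mulSucc m l), h, numDigits_bits (geomSum_lt m r hm)]

theorem geomSize_le {m r : ℕ} (hm : 1 ≤ m) : geomSize m r ≤ m * r := by
  rw [geomSize_eq hm, Nat.size_le]
  exact geomSum_lt m r hm

theorem geomSum_succ_le (m r : ℕ) (hm : 2 ≤ m) : (m - 1) * geomSum m r + 1 = m ^ r := by
  obtain ⟨k, rfl⟩ : ∃ k, m = k + 1 := ⟨m - 1, by omega⟩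
  induction r with
  | zero => simp [geomSum]
  | succ r ih =>
    rw [pow_succ, ← ih, geomSum]
    simp only [Nat.add_sub_cancel]
    ring

/-- A positive number with s digits is at least 2^(s-1). For m ≥ 3 the lost factor 2 is absorbed by
m - 1, because (m - 1) times the geometric sum is m^r - 1. For m = 2 the sum is 2^r - 1, which has
at most r digits. -/
theorem two_pow_geomSize_le {m r : ℕ} (hm : 2 ≤ m) (hr : 1 ≤ r) : 2 ^ geomSize m r ≤ m ^ r := by
  rw [geomSize_eq (by omega)]
  rcases eq_or_lt_of_le hm with rfl | hm'
  · refine Nat.pow_le_pow_right (by norm_num) ?_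
    rw [Nat.size_le]
    have := geomSum_succ_le 2 r le_rfl
    omega
  · have hpos : 0 < geomSum m r := by
      obtain ⟨k, rfl⟩ : ∃ k, r = k + 1 := ⟨r - 1, by omega⟩
      rw [geomSum]; omega
    have hs : 0 < (geomSum m r).size := Nat.size_pos.2 hpos
    have h1 : 2 ^ ((geomSum m r).size - 1) ≤ geomSum m r := Nat.lt_size.1 (by omega)
    have h2 : 2 ^ (geomSum m r).size = 2 * 2 ^ ((geomSum m r).size - 1) := by
      rw [← pow_succ']; congr 1; omega
    have h3 := geomSum_succ_le m r hm
    have h4 : 2 * geomSum m r ≤ (m - 1) * geomSum m r := Nat.mul_le_mul_right _ (by omega)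
    omega

theorem geomSize_le_logb {m r : ℕ} (hm : 2 ≤ m) (hr : 1 ≤ r) :
    (geomSize m r : ℝ) ≤ r * Real.logb 2 m := by
  have h : ((2 ^ geomSize m r : ℕ) : ℝ) ≤ ((m ^ r : ℕ) : ℝ) :=
    Nat.cast_le.2 (two_pow_geomSize_le hm hr)
  push_cast at h
  have h2 := Real.logb_le_logb_of_le (b := 2) (by norm_num) (by positivity) h
  rwa [Real.logb_pow, Real.logb_pow, Real.logb_self_eq_one (by norm_num), mul_one] at h2

/-! ### Computing the number of bits, and reading off the automaton, in polynomial time -/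

section
variable {α : Type} [Enc α]

theorem iterate_half (k : ℕ) :
    (fun s : ℕ × Bool => bif s.2 then (s.1 + 1, false) else (s.1, true))^[k] (0, false) =
      (k / 2, decide (k % 2 = 1)) := by
  induction k with
  | zero => rfl
  | succ k ih =>
    rw [Function.iterate_succ_apply', ih]
    rcases Nat.mod_two_eq_zero_or_one k with h | h
    · simp only [h, zero_ne_one, decide_false, cond_false, Prod.mk.injEq]
      refine ⟨by omega, (decide_eq_true ?_).symm⟩; omega
    · simp only [h, decide_true, cond_true, Prod.mk.injEq]
      refine ⟨by omega, (decide_eq_false ?_).symm⟩; omega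

@[fun_prop]
theorem PT.half {f : α → ℕ} (hf : PT f) : PT fun x => f x / 2 := by
  have h : PT fun x => (List.replicate (f x) ()).foldl
      (fun (s : ℕ × Bool) _ => bif s.2 then (s.1 + 1, false) else (s.1, true)) (0, false) := by
    refine hf.units.foldl_of_bound (by fun_prop) (by fun_prop)
      (b := fun x => 4 + esize (f x)) ((PB.const 4).add hf.pb_esize) fun x l₁ h => ?_
    obtain ⟨hle, hl₁⟩ := List.prefix_replicate_iff.1 h
    rw [hl₁]
    generalize l₁.length = k at hle
    rw [foldl_units (fun s : ℕ × Bool => bif s.2 then (s.1 + 1, false) else (s.1, true)),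
      iterate_half, esize_pair, esize_nat, esize_nat]
    have := esize_bool_le (decide (k % 2 = 1))
    omega
  refine (PT.fst.comp h).congr fun x => ?_
  rw [foldl_units (fun s : ℕ × Bool => bif s.2 then (s.1 + 1, false) else (s.1, true)),
    iterate_half]

@[fun_prop]
theorem PT.mulStep {f : α → ℕ} {g : α → ℕ × List Bool} {h : α → Bool} (hf : PT f) (hg : PT g)
    (hh : PT h) : PT fun x => mulStep (f x) (g x) (h x) := by
  unfold DFALearning.mulStep; fun_prop

theorem length_foldl_mulStep (m : ℕ) (l : List Bool) (s : ℕ × List Bool) :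
    (l.foldl (mulStep m) s).2.length = l.length + s.2.length := by
  induction l generalizing s with
  | nil => simp
  | cons b l ih => rw [List.foldl_cons, ih]; simp [DFALearning.mulStep]; omega

/-- This keeps the unary carry small: half of (m + 1) + m is at most m. -/
theorem foldl_mulStep_carry_le (m : ℕ) (l : List Bool) (s : ℕ × List Bool) (hs : s.1 ≤ m + 1) :
    (l.foldl (mulStep m) s).1 ≤ m + 1 := by
  induction l generalizing s with
  | nil => exact hs
  | cons b l ih =>
    refine ih _ ?_
    simp only [DFALearning.mulStep]
    cases b <;> simp <;> omega

theorem esize_bools_le (l : List Bool) : esize l ≤ 1 + l.length * 4 :=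
  esize_list_le fun b _ => esize_bool_le b

@[fun_prop]
theorem PT.mulSucc {f : α → ℕ} {g : α → List Bool} (hf : PT f) (hg : PT g) :
    PT fun x => mulSucc (f x) (g x) := by
  have h : PT fun x => (g x).foldl (DFALearning.mulStep (f x)) (1, []) := by
    refine hg.foldl_of_bound (by fun_prop) (by fun_prop)
      (b := fun x => 4 + esize (f x) + esize (g x) * 4)
      (((PB.const 4).add hf.pb_esize).add (hg.pb_esize.mul (.const 4))) fun x l₁ h => ?_
    have h1 := length_foldl_mulStep (f x) l₁ (1, [])
    have h2 := foldl_mulStep_carry_le (f x) l₁ (1, []) (by simp)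
    have h3 := h.length_le.trans (length_le_esize _)
    have h4 := esize_bools_le (l₁.foldl (DFALearning.mulStep (f x)) (1, [])).2
    rw [esize_prod, esize_nat, esize_nat]
    simp only [List.length_nil, add_zero] at h1
    omega
  unfold DFALearning.mulSucc
  fun_prop

@[fun_prop]
theorem PT.numDigits {f : α → List Bool} (hf : PT f) : PT fun x => numDigits (f x) := by
  refine hf.foldl_of_bound (s := fun _ k b => bif b || decide (0 < k) then k + 1 else 0)
    (i := fun _ => 0) (by fun_prop) (by fun_prop)
    (b := fun x => 1 + 2 * esize (f x)) ((PB.const 1).add ((PB.const 2).mul hf.pb_esize))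
    fun x l₁ h => ?_
  have h1 : ∀ l : List Bool,
      l.foldl (fun k b => bif b || decide (0 < k) then k + 1 else 0) 0 ≤ l.length := by
    intro l
    induction l using List.reverseRecOn with
    | nil => simp
    | append_singleton l a ih =>
      rw [List.foldl_append, List.length_append]
      simp only [List.foldl_cons, List.foldl_nil, List.length_singleton]
      rw [cond_eq_ite]
      split_ifs <;> omega
  have h2 := h1 l₁
  have h3 := h.length_le.trans (length_le_esize _)
  rw [esize_nat]
  omega

-- The geometric sum is exponential in `r`, so it is never written in unary: the fold keeps a list
-- of exactly m · r binary digits, and only the digit count becomes a unary number.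
@[fun_prop]
theorem PT.geomSize {f g : α → ℕ} (hf : PT f) (hg : PT g) : PT fun x => geomSize (f x) (g x) := by
  have h : PT fun x => (List.replicate (g x) ()).foldl (fun l _ => DFALearning.mulSucc (f x) l)
      ((List.range (f x * g x)).map fun _ => false) := by
    refine hg.units.foldl_of_invariant (by fun_prop) (by fun_prop)
      (b := fun x => 1 + esize (f x) * esize (g x) * 4)
      ((PB.const 1).add ((hf.pb_esize.mul hg.pb_esize).mul (.const 4)))
      (fun x l => l.length = f x * g x) (by simp) (fun x l _ hl => ?_) (fun x l hl => ?_)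
    · rw [DFALearning.mulSucc, List.length_reverse, length_foldl_mulStep, hl]; simp
    · refine (esize_bools_le l).trans ?_
      rw [hl, esize_nat, esize_nat]
      gcongr <;> omega
  unfold DFALearning.geomSize
  fun_prop

/-! ### Reading an automaton off a valuation -/

/-- The value of a variable under a valuation given by the list of its values. -/
def lookup (l : List Bool) (i : ℕ) : Bool := l.getD i false

/-- The first `q' < n` to which `a` leads from `q` under the valuation `v`. -/
def readStep (n : ℕ) (v : ℕ → Bool) (q a : ℕ) : ℕ :=
  ((List.range n).flatMap fun q' => bif v (varStep q a q') then [q'] else []).headD 0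

/-- The components of the automaton described by a list of values. -/
def readDFA (m n : ℕ) (l : List Bool) : ℕ × List (List ℕ) × List Bool :=
  (0, (List.range n).map fun q => (List.range m).map fun a => readStep n (lookup l) q a,
    (List.range n).map fun q => !lookup l (varReject q))

@[fun_prop]
theorem PT.readDFA {f g : α → ℕ} {h : α → List Bool} (hf : PT f) (hg : PT g) (hh : PT h) :
    PT fun x => readDFA (f x) (g x) (h x) := by
  unfold DFALearning.readDFA DFALearning.readStep DFALearning.lookup; fun_prop

end
end DFALearning

namespace DFALearning

/-! ### Binary addition -/

/-- The number with the binary digits `x 0, …, x (b - 1)`. -/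
def binVal (x : ℕ → Bool) : ℕ → ℕ
  | 0 => 0
  | b + 1 => 2 ^ b * (x b).toNat + binVal x b

theorem binVal_lt (x : ℕ → Bool) (b : ℕ) : binVal x b < 2 ^ b := by
  induction b with
  | zero => simp [binVal]
  | succ b ih =>
    rw [binVal, pow_succ]
    have := Bool.toNat_le (x b)
    nlinarith

theorem testBit_binVal (x : ℕ → Bool) {b j : ℕ} (hj : j < b) :
    (binVal x b).testBit j = x j := by
  induction b with
  | zero => omega
  | succ b ih =>
    rw [binVal, Nat.testBit_two_pow_mul_add _ (binVal_lt x b)]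
    split_ifs with h
    · exact ih h
    · obtain rfl : j = b := by omega
      cases x j <;> simp

theorem binVal_eq_zero {x : ℕ → Bool} {b : ℕ} (h : ∀ j < b, x j = false) : binVal x b = 0 := by
  induction b with
  | zero => rfl
  | succ b ih => rw [binVal, h b (by omega), ih fun j hj => h j (by omega)]; simp

theorem binVal_eq_toNat {x : ℕ → Bool} {b : ℕ} (h : ∀ j < b, x (j + 1) = false) :
    binVal x (b + 1) = (x 0).toNat := by
  induction b with
  | zero => simp [binVal]
  | succ b ih => rw [binVal, h b (by omega), ih fun j hj => h j (by omega)]; simp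

/-- Correctness of the ripple-carry adder: at each position k, the digits of `z` below k plus 2^k
times the carry give the sum of the lower parts. With no carry out of the last column the sum is
exact. -/
theorem binVal_add {x y c z : ℕ → Bool} {b : ℕ} (h0 : c 0 = false) (hb : c b = false)
    (h : ∀ j < b, FullAdder (x j) (y j) (c j) (z j) (c (j + 1))) :
    binVal z b = binVal x b + binVal y b := by
  have key : ∀ k ≤ b, binVal z k + 2 ^ k * (c k).toNat = binVal x k + binVal y k := by
    intro k
    induction k with
    | zero => simp [binVal, h0]
    | succ k ih =>
      intro hk
      have h1 := ih (by omega)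
      have h2 := h k (by omega)
      unfold FullAdder at h2
      simp only [binVal, pow_succ]
      have h3 := congrArg (2 ^ k * ·) h2
      simp only [mul_add] at h3
      linarith
  simpa [hb] using key b le_rfl

/-- The carry into the digit `j` of the sum of `x` and `y`. -/
def carry (x y j : ℕ) : Bool := decide (2 ^ j ≤ x % 2 ^ j + y % 2 ^ j)

theorem toNat_testBit (x j : ℕ) : (x.testBit j).toNat = x / 2 ^ j % 2 := by
  rw [Nat.testBit_eq_decide_div_mod_eq]
  rcases Nat.mod_two_eq_zero_or_one (x / 2 ^ j) with h | h <;> simp [h]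

theorem toNat_carry (x y j : ℕ) : (carry x y j).toNat = (x % 2 ^ j + y % 2 ^ j) / 2 ^ j := by
  have h2 : 0 < 2 ^ j := by positivity
  have hx := Nat.mod_lt x h2
  have hy := Nat.mod_lt y h2
  unfold carry
  by_cases h : 2 ^ j ≤ x % 2 ^ j + y % 2 ^ j
  · rw [decide_eq_true h]
    symm
    rw [Nat.div_eq_iff h2, Bool.toNat_true]
    omega
  · rw [decide_eq_false h, Nat.div_eq_of_lt (by omega)]
    rfl

/-- The carry into column j is the quotient by 2^j of the sum of the two remainders. The next carry
is then half of this carry plus the two digits, rounded down, as a full adder demands. -/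
theorem fullAdder_carry (x y j : ℕ) : FullAdder (x.testBit j) (y.testBit j) (carry x y j)
    ((x + y).testBit j) (carry x y (j + 1)) := by
  have h2 : 0 < 2 ^ j := by positivity
  unfold FullAdder
  simp only [toNat_testBit, toNat_carry]
  have hx : x % 2 ^ (j + 1) = x % 2 ^ j + 2 ^ j * (x / 2 ^ j % 2) := Nat.mod_pow_succ
  have hy : y % 2 ^ (j + 1) = y % 2 ^ j + 2 ^ j * (y / 2 ^ j % 2) := Nat.mod_pow_succ
  have hs : (x + y) / 2 ^ j = (x % 2 ^ j + y % 2 ^ j) / 2 ^ j + x / 2 ^ j + y / 2 ^ j := by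
    conv_lhs => rw [← Nat.mod_add_div x (2 ^ j), ← Nat.mod_add_div y (2 ^ j)]
    rw [show x % 2 ^ j + 2 ^ j * (x / 2 ^ j) + (y % 2 ^ j + 2 ^ j * (y / 2 ^ j)) =
      x % 2 ^ j + y % 2 ^ j + 2 ^ j * (x / 2 ^ j + y / 2 ^ j) by ring,
      Nat.add_mul_div_left _ _ h2, add_assoc]
  have hc : (x % 2 ^ (j + 1) + y % 2 ^ (j + 1)) / 2 ^ (j + 1) =
      ((x % 2 ^ j + y % 2 ^ j) / 2 ^ j + x / 2 ^ j % 2 + y / 2 ^ j % 2) / 2 := by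
    rw [pow_succ, ← Nat.div_div_eq_div_mul, ← pow_succ, hx, hy,
      show x % 2 ^ j + 2 ^ j * (x / 2 ^ j % 2) + (y % 2 ^ j + 2 ^ j * (y / 2 ^ j % 2)) =
        x % 2 ^ j + y % 2 ^ j + 2 ^ j * (x / 2 ^ j % 2 + y / 2 ^ j % 2) by ring,
      Nat.add_mul_div_left _ _ h2, add_assoc]
  rw [hc, hs]
  omega

theorem carry_zero (x y : ℕ) : carry x y 0 = false := by simp [carry, Nat.mod_one]

theorem carry_eq_false {x y b : ℕ} (h : x + y < 2 ^ b) : carry x y b = false := by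
  unfold carry
  rw [Nat.mod_eq_of_lt (by omega), Nat.mod_eq_of_lt (by omega)]
  exact decide_eq_false (by omega)

/-! ### Counting accepted words -/

/-- The number of words of length less than `i` over the letters `0, …, m - 1` which are accepted
from the state `q` by the automaton with transition function `δ` and final states `f`. -/
def countFrom (m : ℕ) (δ : ℕ → ℕ → ℕ) (f : ℕ → Bool) : ℕ → ℕ → ℕ
  | 0, _ => 0
  | i + 1, q => (f q).toNat + ∑ a ∈ Finset.range m, countFrom m δ f i (δ q a)

/-- The part of `countFrom` given by the empty word and the words that start with a letter less
than `a`. -/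
def countUpTo (m : ℕ) (δ : ℕ → ℕ → ℕ) (f : ℕ → Bool) (i q a : ℕ) : ℕ :=
  match i with
  | 0 => 0
  | i + 1 => (f q).toNat + ∑ a' ∈ Finset.range a, countFrom m δ f i (δ q a')

section
variable {m : ℕ} {δ : ℕ → ℕ → ℕ} {f : ℕ → Bool}

theorem countUpTo_self (i q : ℕ) : countUpTo m δ f i q m = countFrom m δ f i q := by
  cases i <;> rfl

theorem countUpTo_succ (i q a : ℕ) : countUpTo m δ f (i + 1) q (a + 1) =
    countUpTo m δ f (i + 1) q a + countFrom m δ f i (δ q a) := by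
  simp only [countUpTo, Finset.sum_range_succ, add_assoc]

theorem countUpTo_le {i q a : ℕ} (ha : a ≤ m) :
    countUpTo m δ f i q a ≤ countFrom m δ f i q := by
  cases i with
  | zero => simp [countUpTo]
  | succ i =>
    simp only [countUpTo, countFrom]
    gcongr

theorem countFrom_le (i q : ℕ) : countFrom m δ f i q ≤ geomSum m i := by
  induction i generalizing q with
  | zero => simp [countFrom]
  | succ i ih =>
    rw [countFrom, geomSum]
    refine add_le_add (Bool.toNat_le _) ((Finset.sum_le_sum fun a _ => ih _).trans ?_)
    simp

theorem geomSum_mono (hm : 1 ≤ m) : Monotone (geomSum m) :=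
  monotone_nat_of_le_succ fun i => by rw [geomSum]; nlinarith

end

/-! ### The meaning of the formulas -/

/-- The literal `l` is true under the valuation `v`. -/
def Lit.Holds (v : ℕ → Bool) (l : Lit) : Prop := v (Prod.fst l) = Prod.snd l

@[simp] theorem Lit.holds_mk (v : ℕ → Bool) (i : ℕ) (b : Bool) :
    (Lit.mk i b).Holds v ↔ v i = b := Iff.rfl

/-- The valuation `v` satisfies the formula `φ`. -/
def Satisfies (v : ℕ → Bool) (φ : List (List Lit)) : Prop := ∀ C ∈ φ, ∃ l ∈ C, l.Holds v

section
variable {v : ℕ → Bool}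

theorem satisfies_append {φ ψ : List (List Lit)} :
    Satisfies v (φ ++ ψ) ↔ Satisfies v φ ∧ Satisfies v ψ := by
  simp only [Satisfies, List.mem_append, or_imp, forall_and]

theorem satisfies_cons {C : List Lit} {φ : List (List Lit)} :
    Satisfies v (C :: φ) ↔ (∃ l ∈ C, l.Holds v) ∧ Satisfies v φ := by
  simp [Satisfies]

theorem satisfies_nil : Satisfies v [] := by simp [Satisfies]

theorem satisfies_flatMap_range {k : ℕ} {φ : ℕ → List (List Lit)} :
    Satisfies v ((List.range k).flatMap φ) ↔ ∀ i < k, Satisfies v (φ i) := by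
  simp only [Satisfies, List.mem_flatMap, List.mem_range]
  exact ⟨fun h i hi C hC => h C ⟨i, hi, hC⟩, fun h C ⟨i, hi, hC⟩ => h i hi C hC⟩

theorem satisfies_map {β : Type} {l : List β} {C : β → List Lit} :
    Satisfies v (l.map C) ↔ ∀ i ∈ l, ∃ l ∈ C i, l.Holds v := by
  simp [Satisfies]

theorem satisfies_stepClauses {m n : ℕ} : Satisfies v (stepClauses m n) ↔
    ∀ q < n, ∀ a < m, ∃ q' < n, v (varStep q a q') = true := by
  simp [stepClauses, satisfies_flatMap_range, satisfies_map]

theorem satisfies_wordClauses {n : ℕ} {l : List (List ℕ)} : Satisfies v (wordClauses n l) ↔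
    ∀ i < l.length, v (varReach i 0 0) = true ∧
      (∀ j < (l.getD i []).length, ∀ q < n, ∀ q' < n, v (varReach i j q) = true →
        v (varStep q ((l.getD i []).getD j 0) q') = true → v (varReach i (j + 1) q') = true) ∧
      ∀ q < n, v (varReach i (l.getD i []).length q) = true → v (varReject q) = false := by
  simp [wordClauses, satisfies_flatMap_range, satisfies_map, satisfies_cons, satisfies_append,
    ← Bool.not_eq_true, ← imp_iff_not_or]

theorem satisfies_zeroClauses {m n b : ℕ} : Satisfies v (zeroClauses m n b) ↔
    ∀ q < n, ∀ j < b, v (varSum 0 q m j) = false := by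
  simp [zeroClauses, satisfies_flatMap_range, satisfies_map]

theorem satisfies_finalClauses {n r b : ℕ} : Satisfies v (finalClauses n r b) ↔
    ∀ i < r, ∀ q < n, v (varSum (i + 1) q 0 0) = !v (varReject q) ∧
      ∀ j < b - 1, v (varSum (i + 1) q 0 (j + 1)) = false := by
  simp only [finalClauses, satisfies_flatMap_range, satisfies_map, satisfies_cons]
  refine forall₄_congr fun i _ q _ => ?_
  simp only [List.mem_cons, List.not_mem_nil, or_false, exists_eq_or_imp, exists_eq_left,
    Lit.holds_mk, List.mem_range]
  cases v (varSum (i + 1) q 0 0) <;> cases v (varReject q) <;> simp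

theorem satisfies_carryClauses {m n r b : ℕ} : Satisfies v (carryClauses m n r b) ↔
    ∀ i < r, ∀ q < n, ∀ a < m, v (varCarry i q a 0) = false ∧ v (varCarry i q a b) = false := by
  simp [carryClauses, satisfies_flatMap_range, satisfies_cons, satisfies_nil]

theorem satisfies_adderClauses {m n r b : ℕ} : Satisfies v (adderClauses m n r b) ↔
    ∀ i < r, ∀ q < n, ∀ a < m, ∀ q' < n, ∀ j < b, v (varStep q a q') = true →
      FullAdder (v (varSum (i + 1) q a j)) (v (varSum i q' m j)) (v (varCarry i q a j))
        (v (varSum (i + 1) q (a + 1) j)) (v (varCarry i q a (j + 1))) := by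
  simp only [adderClauses, satisfies_flatMap_range, satisfies_map]
  refine forall₄_congr fun i _ q _ => forall₄_congr fun a _ q' _ => forall₂_congr fun j _ => ?_
  simp only [List.mem_cons, List.not_mem_nil, or_false, exists_eq_or_imp, exists_eq_left,
    Lit.holds_mk, Prod.forall]
  generalize v (varStep q a q') = s
  generalize v (varSum (i + 1) q a j) = x
  generalize v (varSum i q' m j) = y
  generalize v (varCarry i q a j) = c
  generalize v (varSum (i + 1) q (a + 1) j) = z
  generalize v (varCarry i q a (j + 1)) = d
  constructor
  · intro h hs
    by_contra hbad
    have := h x y c z d ((mem_badColumns x y c z d).2 hbad)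
    simp [hs] at this
  · intro h x' y' c' z' d' hbad
    by_contra hne
    simp only [not_or, Bool.not_eq_not, Bool.not_eq_false] at hne
    obtain ⟨hs, rfl, rfl, rfl, rfl, rfl⟩ := hne
    exact (mem_badColumns _ _ _ _ _).1 hbad (h hs)

theorem satisfies_bitClauses {m r k : ℕ} {p : List Bool} : Satisfies v (bitClauses m r k p) ↔
    ∀ i < p.length, v (varSum r 0 m (k + i)) = p.getD i false := by
  simp [bitClauses, satisfies_map]

end

/-- The automaton with states `0, …, n - 1`, initial state `0`, transition function `δ` and final
states `f` is well-defined and accepts the words of `l`. -/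
structure Consistent (m n : ℕ) (l : List (List ℕ)) (δ : ℕ → ℕ → ℕ) (f : ℕ → Bool) : Prop where
  step_lt : ∀ q < n, ∀ a < m, δ q a < n
  accepts : ∀ w ∈ l, f (w.foldl δ 0) = true

theorem readStep_spec {n : ℕ} {v : ℕ → Bool} {q a : ℕ}
    (h : ∃ q' < n, v (varStep q a q') = true) :
    readStep n v q a < n ∧ v (varStep q a (readStep n v q a)) = true := by
  have hmem : ∀ q', q' ∈ ((List.range n).flatMap fun q' =>
      bif v (varStep q a q') then [q'] else []) ↔ q' < n ∧ v (varStep q a q') = true := by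
    intro q'
    simp only [List.mem_flatMap, List.mem_range]
    constructor
    · rintro ⟨p, hp, h⟩
      cases hv : v (varStep q a p) with
      | false => simp [hv] at h
      | true =>
        simp only [hv, cond_true, List.mem_singleton] at h
        subst h
        exact ⟨hp, hv⟩
    · rintro ⟨h1, h2⟩
      exact ⟨q', h1, by simp [h2]⟩
  unfold readStep
  cases hl : ((List.range n).flatMap fun q' => bif v (varStep q a q') then [q'] else []) with
  | nil =>
    obtain ⟨q', hq'⟩ := h
    have := (hmem q').2 hq'
    simp [hl] at this
  | cons x l =>
    refine (hmem x).1 ?_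
    rw [hl]
    simp

theorem foldl_lt {m n : ℕ} {δ : ℕ → ℕ → ℕ} (h : ∀ q < n, ∀ a < m, δ q a < n) {w : List ℕ}
    (hw : ∀ a ∈ w, a < m) {q : ℕ} (hq : q < n) : w.foldl δ q < n := by
  induction w generalizing q with
  | nil => exact hq
  | cons a w ih =>
    exact ih (fun c hc => hw c (by simp [hc])) (h q hq a (hw a (by simp)))

/-- A valuation may mark several successors for one state and letter. The clauses hold for each
marked one, so they survive the choice of the first. The reach variables need only include the
actual run, since any state marked at the end of a word is forced to be final. -/
theorem formula_sound {m n r b k : ℕ} {l : List (List ℕ)} {p : List Bool} {v : ℕ → Bool}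
    (hn : 1 ≤ n) (hb : 1 ≤ b) (hl : ∀ w ∈ l, ∀ a ∈ w, a < m) (hk : k + p.length ≤ b)
    (h : Satisfies v (formula m n r b l k p)) :
    Consistent m n l (readStep n v) (fun q => !v (varReject q)) ∧
      ∀ i < p.length, (countFrom m (readStep n v) (fun q => !v (varReject q)) r 0).testBit (k + i)
        = p.getD i false := by
  simp only [formula, satisfies_append, satisfies_stepClauses, satisfies_wordClauses,
    satisfies_zeroClauses, satisfies_finalClauses, satisfies_carryClauses,
    satisfies_adderClauses, satisfies_bitClauses] at h
  obtain ⟨hstep, hword, hzero, hfinal, hcarry, hadd, hbit⟩ := h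
  have hlt : ∀ q < n, ∀ a < m, readStep n v q a < n := fun q hq a ha =>
    (readStep_spec (hstep q hq a ha)).1
  refine ⟨⟨hlt, ?_⟩, ?_⟩
  · intro w hw
    obtain ⟨i, hi, rfl⟩ := List.mem_iff_getElem.1 hw
    obtain ⟨h0, h1, h2⟩ := hword i hi
    rw [List.getD_eq_getElem _ _ hi] at h1 h2
    have hreach : ∀ j ≤ l[i].length,
        v (varReach i j ((l[i].take j).foldl (readStep n v) 0)) = true := by
      intro j
      induction j with
      | zero => exact fun _ => h0
      | succ j ih =>
        intro hj
        have hq : (l[i].take j).foldl (readStep n v) 0 < n :=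
          foldl_lt hlt (fun a ha => hl _ hw a (List.mem_of_mem_take ha)) hn
        have ha : l[i].getD j 0 < m := by
          rw [List.getD_eq_getElem _ _ hj]
          exact hl _ hw _ (List.getElem_mem _)
        have hs := readStep_spec (hstep _ hq _ ha)
        have := h1 j hj _ hq _ hs.1 (ih (by omega)) hs.2
        rwa [List.take_succ_eq_append_getElem hj, List.foldl_append, List.foldl_cons,
          List.foldl_nil, ← List.getD_eq_getElem _ 0 hj]
    have := hreach _ le_rfl
    rw [List.take_length] at this
    rw [h2 _ (foldl_lt hlt (hl _ hw) hn) this]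
    rfl
  -- The outer induction is on the length bound, the inner one on the letters already summed.
  -- Excluding a carry out of bit b - 1 makes each addition exact.
  · have hsum : ∀ i ≤ r, ∀ q < n, binVal (fun j => v (varSum i q m j)) b =
        countFrom m (readStep n v) (fun q => !v (varReject q)) i q := by
      intro i
      induction i with
      | zero => exact fun _ q hq => binVal_eq_zero (hzero q hq)
      | succ i ih =>
        intro hi q hq
        have hup : ∀ a ≤ m, binVal (fun j => v (varSum (i + 1) q a j)) b =
            countUpTo m (readStep n v) (fun q => !v (varReject q)) (i + 1) q a := by
          intro a
          induction a with
          | zero =>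
            intro _
            obtain ⟨h0, h1⟩ := hfinal i hi q hq
            obtain ⟨b, rfl⟩ : ∃ b', b = b' + 1 := ⟨b - 1, by omega⟩
            rw [binVal_eq_toNat h1, h0]
            simp [countUpTo]
          | succ a iha =>
            intro ha
            have hs := readStep_spec (hstep q hq a ha)
            obtain ⟨hc0, hcb⟩ := hcarry i hi q hq a ha
            rw [countUpTo_succ, ← iha (by omega), ← ih (by omega) _ hs.1]
            exact binVal_add (c := fun j => v (varCarry i q a j)) hc0 hcb
              fun j hj => hadd i hi q hq a ha _ hs.1 j hj hs.2
        rw [hup m le_rfl, countUpTo_self]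
    intro i hi
    rw [← hsum r le_rfl 0 hn, testBit_binVal _ (by omega), hbit i hi]

/-- The valuation that describes an automaton. -/
def describe (m : ℕ) (l : List (List ℕ)) (δ : ℕ → ℕ → ℕ) (f : ℕ → Bool) (x : ℕ) : Bool :=
  match x.unpair.1 with
  | 0 => decide (δ x.unpair.2.unpair.1 x.unpair.2.unpair.2.unpair.1 =
      x.unpair.2.unpair.2.unpair.2)
  | 1 => !f x.unpair.2
  | 2 => (countUpTo m δ f x.unpair.2.unpair.1 x.unpair.2.unpair.2.unpair.1
      x.unpair.2.unpair.2.unpair.2.unpair.1).testBit x.unpair.2.unpair.2.unpair.2.unpair.2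
  | 3 => carry (countUpTo m δ f (x.unpair.2.unpair.1 + 1) x.unpair.2.unpair.2.unpair.1
      x.unpair.2.unpair.2.unpair.2.unpair.1)
      (countFrom m δ f x.unpair.2.unpair.1 (δ x.unpair.2.unpair.2.unpair.1
        x.unpair.2.unpair.2.unpair.2.unpair.1)) x.unpair.2.unpair.2.unpair.2.unpair.2
  | _ => decide (((l.getD x.unpair.2.unpair.1 []).take x.unpair.2.unpair.2.unpair.1).foldl δ 0 =
      x.unpair.2.unpair.2.unpair.2)

section
variable {m : ℕ} {l : List (List ℕ)} {δ : ℕ → ℕ → ℕ} {f : ℕ → Bool}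

theorem describe_varStep (q a q' : ℕ) :
    describe m l δ f (varStep q a q') = decide (δ q a = q') := by
  simp [describe, varStep]

theorem describe_varReject (q : ℕ) : describe m l δ f (varReject q) = !f q := by
  simp [describe, varReject]

theorem describe_varSum (i q a j : ℕ) :
    describe m l δ f (varSum i q a j) = (countUpTo m δ f i q a).testBit j := by
  simp [describe, varSum]

theorem describe_varCarry (i q a j : ℕ) : describe m l δ f (varCarry i q a j) =
    carry (countUpTo m δ f (i + 1) q a) (countFrom m δ f i (δ q a)) j := by
  simp [describe, varCarry]

theorem describe_varReach (i j q : ℕ) : describe m l δ f (varReach i j q) =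
    decide (((l.getD i []).take j).foldl δ 0 = q) := by
  simp [describe, varReach]

/-- The valuation records the true runs, partial sums and carries. Only the no-overflow clauses
depend on the width: every partial sum is at most `geomSum m r`, which is below 2^b. -/
theorem formula_complete {n r b k : ℕ} {p : List Bool} (hm : 1 ≤ m) (hb : geomSum m r < 2 ^ b)
    (h : Consistent m n l δ f)
    (hp : ∀ i < p.length, (countFrom m δ f r 0).testBit (k + i) = p.getD i false) :
    Satisfies (describe m l δ f) (formula m n r b l k p) := by
  simp only [formula, satisfies_append, satisfies_stepClauses, satisfies_wordClauses,
    satisfies_zeroClauses, satisfies_finalClauses, satisfies_carryClauses,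
    satisfies_adderClauses, satisfies_bitClauses, describe_varStep, describe_varReject,
    describe_varSum, describe_varCarry, describe_varReach, decide_eq_true_eq]
  refine ⟨fun q hq a ha => ⟨_, h.step_lt q hq a ha, rfl⟩, fun i hi => ⟨rfl, ?_, ?_⟩, ?_, ?_, ?_,
    ?_, ?_⟩
  · rintro j hj q - q' - rfl rfl
    rw [List.take_succ_eq_append_getElem hj, List.foldl_append, List.foldl_cons,
      List.foldl_nil, ← List.getD_eq_getElem _ 0 hj]
  · rintro q - rfl
    rw [List.take_length, h.accepts]
    · rfl
    · rw [List.getD_eq_getElem _ _ hi]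
      exact List.getElem_mem _
  · intro q _ j _
    simp [countUpTo]
  · intro i _ q _
    simp only [countUpTo, Finset.range_zero, Finset.sum_empty, add_zero]
    cases f q <;> simp [Nat.testBit_succ]
  · intro i hi q _ a ha
    refine ⟨carry_zero _ _, carry_eq_false ?_⟩
    rw [← countUpTo_succ]
    exact (((countUpTo_le ha).trans (countFrom_le _ _)).trans (geomSum_mono hm hi)).trans_lt hb
  · rintro i - q - a - _ - j - rfl
    rw [countUpTo_self, countUpTo_succ]
    exact fullAdder_carry _ _ _
  · intro i hi
    rw [countUpTo_self]
    exact hp i hi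

end
end DFALearning

namespace DFALearning

open Enc

/-! ### Automata whose states are numbers -/

/-- Splitting the words into the empty one and those with a given first letter mirrors the recursion
of `countFrom`. -/
theorem ncard_accepted (m : ℕ) (δ : ℕ → ℕ → ℕ) (f : ℕ → Bool) (i q : ℕ) :
    {w : List (Fin m) | f ((w.map Fin.val).foldl δ q) = true ∧ w.length < i}.ncard =
      countFrom m δ f i q := by
  induction i generalizing q with
  | zero => simp [countFrom]
  | succ i ih =>
    have hfin : ∀ (i q : ℕ),
        {w : List (Fin m) | f ((w.map Fin.val).foldl δ q) = true ∧ w.length < i}.Finite :=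
      fun i q => (List.finite_length_lt (Fin m) i).subset fun w hw => hw.2
    have hsplit : {w : List (Fin m) | f ((w.map Fin.val).foldl δ q) = true ∧ w.length < i + 1} =
        {w : List (Fin m) | f q = true ∧ w = []} ∪ ⋃ a : Fin m, List.cons a ''
          {w : List (Fin m) | f ((w.map Fin.val).foldl δ (δ q a)) = true ∧ w.length < i} := by
      ext w
      cases w with
      | nil => simp
      | cons a w => simp
    rw [hsplit, Set.ncard_union_eq ?_ ((Set.finite_singleton []).subset fun w hw => hw.2)
      (Set.finite_iUnion fun a => (hfin _ _).image _),
      Set.ncard_iUnion_of_finite (fun a => (hfin _ _).image _), finsum_eq_sum_of_fintype, countFrom,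
      ← Fin.sum_univ_eq_sum_range (fun a => countFrom m δ f i (δ q a))]
    · congr 1
      · cases f q <;> simp
      · refine Finset.sum_congr rfl fun a _ => ?_
        rw [Set.ncard_image_of_injective _ (List.cons_injective), ih]
    · intro a b hab
      rw [Function.onFun, Set.disjoint_left]
      rintro _ ⟨w, -, rfl⟩ ⟨w', -, h⟩
      exact hab (List.cons.inj h).1.symm
    · rw [Set.disjoint_left]
      rintro _ ⟨-, rfl⟩ h
      simp at h

/-- The language of `A` is given by the transition function `δ` and the final states `f` on
numbers. -/
def Represents {m : ℕ} (δ : ℕ → ℕ → ℕ) (f : ℕ → Bool) (A : FinDFA (Fin m)) : Prop :=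
  ∀ w, w ∈ A.lang ↔ f ((w.map Fin.val).foldl δ 0) = true

theorem Represents.count_eq {m : ℕ} {δ : ℕ → ℕ → ℕ} {f : ℕ → Bool} {A : FinDFA (Fin m)}
    (h : Represents δ f A) (k : ℕ) : A.count k = countFrom m δ f (k + 1) 0 := by
  rw [FinDFA.count, ← ncard_accepted]
  congr 1
  ext w
  simp only [Set.mem_ofPred_eq, h w, Nat.lt_succ_iff]

theorem Represents.consistent_iff {m n : ℕ} {δ : ℕ → ℕ → ℕ} {f : ℕ → Bool} {A : FinDFA (Fin m)}
    (h : Represents δ f A) (hδ : ∀ q < n, ∀ a < m, δ q a < n) {P : Set (List (Fin m))}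
    {l : List (List (Fin m))} (hl : ∀ w, w ∈ l ↔ w ∈ P) :
    Consistent m n (l.map (List.map Fin.val)) δ f ↔ P ⊆ A.lang := by
  constructor
  · intro hc w hw
    exact (h w).2 (hc.accepts _ (List.mem_map_of_mem ((hl w).2 hw)))
  · intro hP
    refine ⟨hδ, fun w hw => ?_⟩
    obtain ⟨w, hwl, rfl⟩ := List.mem_map.1 hw
    exact (h w).1 (hP ((hl w).1 hwl))

/-- The automaton with transition function `δ` and final states `f` on the states
`0, …, n - 1`. -/
def numDFA {m n : ℕ} (hn : 0 < n) (δ : ℕ → ℕ → ℕ) (f : ℕ → Bool)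
    (hδ : ∀ q < n, ∀ a < m, δ q a < n) : DFA (Fin m) (Fin n) where
  step q a := ⟨δ q a, hδ q q.2 a a.2⟩
  start := ⟨0, hn⟩
  accept := {q | f q = true}

theorem represents_numDFA {m n : ℕ} (hn : 0 < n) (δ : ℕ → ℕ → ℕ) (f : ℕ → Bool)
    (hδ : ∀ q < n, ∀ a < m, δ q a < n) :
    Represents δ f { State := Fin n, toDFA := numDFA hn δ f hδ } := by
  have h : ∀ (w : List (Fin m)) (q : Fin n),
      ((numDFA hn δ f hδ).evalFrom q w : ℕ) = (w.map Fin.val).foldl δ q := by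
    intro w
    induction w with
    | nil => intro q; rfl
    | cons a w ih => intro q; rw [DFA.evalFrom_cons, ih]; rfl
  intro w
  change f ((numDFA hn δ f hδ).eval w) = true ↔ _
  rw [DFA.eval, h]
  rfl

theorem exists_represents {m n : ℕ} (A : FinDFA (Fin m)) (hA : A.size ≤ n) :
    ∃ (δ : ℕ → ℕ → ℕ) (f : ℕ → Bool), (∀ q < n, ∀ a < m, δ q a < n) ∧ Represents δ f A := by
  classical
  obtain ⟨e, he, hlt, h0⟩ : ∃ e : A.State → ℕ, Function.Injective e ∧ (∀ s, e s < n) ∧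
      e A.toDFA.start = 0 := by
    let g : A.State ≃ Fin (Fintype.card A.State) := Fintype.equivFin A.State
    have hpos : 0 < Fintype.card A.State := Fintype.card_pos_iff.2 ⟨A.toDFA.start⟩
    -- The swap gives the initial state the number 0.
    refine ⟨fun s => Equiv.swap (g A.toDFA.start) ⟨0, hpos⟩ (g s), ?_, fun s => ?_, ?_⟩
    · exact Fin.val_injective.comp ((Equiv.injective _).comp g.injective)
    · exact (Fin.is_lt _).trans_le hA
    · simp
  have : Nonempty A.State := ⟨A.toDFA.start⟩
  -- If there are fewer than n states, a number that names none behaves like the arbitrary state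
  -- returned by `Function.invFun`; its transitions still end below n.
  refine ⟨fun q a => if h : a < m then e (A.toDFA.step (Function.invFun e q) ⟨a, h⟩) else 0,
    fun q => decide (Function.invFun e q ∈ A.toDFA.accept), fun q _ a ha => ?_, fun w => ?_⟩
  · simp only [ha, dif_pos, hlt]
  · have h : ∀ (w : List (Fin m)) (s : A.State), (w.map Fin.val).foldl
        (fun q a => if h : a < m then e (A.toDFA.step (Function.invFun e q) ⟨a, h⟩) else 0) (e s) =
        e (A.toDFA.evalFrom s w) := by
      intro w
      induction w with
      | nil => intro s; rfl
      | cons a w ih =>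
        intro s
        rw [List.map_cons, List.foldl_cons, DFA.evalFrom_cons, ← ih]
        simp [Function.leftInverse_invFun he s]
    have h' := h w A.toDFA.start
    rw [h0] at h'
    rw [h', decide_eq_true_eq, Function.leftInverse_invFun he]
    rfl

theorem encList_finRange {β : Type} [Enc β] {k : ℕ} {F : Fin k → Data} {g : ℕ → β}
    (h : ∀ i : Fin k, F i = enc (g i)) :
    encList F (List.finRange k) = enc ((List.range k).map g) := by
  rw [← List.map_coe_finRange_eq_range, List.map_map]
  induction List.finRange k with
  | nil => rfl
  | cons a l ih => rw [List.map_cons, enc_cons, encList, h, ih]; rfl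

theorem encDFA_numDFA {m n : ℕ} (hn : 0 < n) (l : List Bool)
    (hδ : ∀ q < n, ∀ a < m, readStep n (lookup l) q a < n) :
    encDFA (numDFA hn (readStep n (lookup l)) (fun q => !lookup l (varReject q)) hδ) =
      enc (readDFA m n l) := by
  classical
  unfold encDFA
  refine congrArg₂ Data.cons rfl (congrArg₂ Data.cons (encList_finRange fun q =>
    encList_finRange fun a => rfl) (encList_finRange fun q => congrArg encBool ?_))
  rw [Bool.eq_iff_iff, decide_eq_true_eq]
  rfl

/-! ### The size of the input -/

theorem encInput_eq (m n : ℕ) (l : List (List (Fin m))) :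
    encInput m n l = enc (m, n, l.map (List.map Fin.val)) := by
  have h1 : ∀ w : List (Fin m), encList (fun a : Fin m => encNat a) w = enc (w.map Fin.val) := by
    intro w
    induction w with
    | nil => rfl
    | cons a w ih => rw [List.map_cons, enc_cons, encList, ih]; rfl
  have h2 : encList (encList fun a : Fin m => encNat a) l = enc (l.map (List.map Fin.val)) := by
    induction l with
    | nil => rfl
    | cons w l ih => rw [List.map_cons, enc_cons, encList, ih, h1]
  rw [encInput, h2]
  rfl

theorem Pref_finite {m : ℕ} {P : Set (List (Fin m))} {l : List (List (Fin m))}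
    (hl : ∀ w, w ∈ l ↔ w ∈ P) : (Pref P).Finite := by
  refine (l.flatMap List.inits).finite_toSet.subset ?_
  rintro u ⟨w, hw, hu⟩
  exact List.mem_flatMap.2 ⟨w, (hl w).2 hw, (List.mem_inits _ _).2 hu⟩

theorem length_le_ncard_Pref {m : ℕ} {P : Set (List (Fin m))} {l : List (List (Fin m))}
    (hn : l.Nodup) (hl : ∀ w, w ∈ l ↔ w ∈ P) : l.length ≤ (Pref P).ncard := by
  classical
  rw [← List.toFinset_card_of_nodup hn, ← Set.ncard_coe_finset]
  refine Set.ncard_le_ncard (fun w hw => ?_) (Pref_finite hl)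
  exact ⟨w, (hl w).1 (by simpa using hw), List.prefix_rfl⟩

/-- A word of length k has k + 1 distinct prefixes. -/
theorem length_word_le_ncard_Pref {m : ℕ} {P : Set (List (Fin m))} {l : List (List (Fin m))}
    (hl : ∀ w, w ∈ l ↔ w ∈ P) {w : List (Fin m)} (hw : w ∈ P) : w.length ≤ (Pref P).ncard := by
  have h : Set.InjOn (fun i => w.take i) (Finset.range (w.length + 1) : Set ℕ) := by
    intro i hi j hj h
    have := congrArg List.length h
    simp at this hi hj
    omega
  have h2 := Set.InjOn.ncard_image h
  rw [Set.ncard_coe_finset, Finset.card_range] at h2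
  have : w.length + 1 ≤ (Pref P).ncard := by
    rw [← h2]
    refine Set.ncard_le_ncard ?_ (Pref_finite hl)
    rintro _ ⟨i, -, rfl⟩
    exact ⟨w, hw, List.take_prefix _ _⟩
  omega

/-- With N = m + |Pref(P)| + n, the list has at most N words, since it has no repetitions; each has
at most N letters, and each letter has size at most 1 + 2N. -/
theorem esize_input_le {m n : ℕ} {P : Set (List (Fin m))} {l : List (List (Fin m))}
    (hn : l.Nodup) (hl : ∀ w, w ∈ l ↔ w ∈ P) :
    esize (m, n, l.map (List.map Fin.val)) ≤
      (Polynomial.C 5 + Polynomial.C 2 * Polynomial.X + Polynomial.X * (Polynomial.C 2 +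
        Polynomial.X * (Polynomial.C 2 + Polynomial.C 2 * Polynomial.X)) :
          Polynomial ℕ).eval (m + (Pref P).ncard + n) := by
  have h1 := length_le_ncard_Pref hn hl
  have h2 : ∀ w ∈ l.map (List.map Fin.val),
      esize w ≤ 1 + (Pref P).ncard * (2 + 2 * m) := by
    intro w hw
    obtain ⟨w, hwl, rfl⟩ := List.mem_map.1 hw
    have h3 := length_word_le_ncard_Pref hl ((hl w).1 hwl)
    refine (esize_list_le (b := 1 + 2 * m) fun a ha => ?_).trans ?_
    · obtain ⟨a, -, rfl⟩ := List.mem_map.1 ha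
      have := a.2
      rw [esize_nat]
      omega
    · rw [List.length_map, ← add_assoc]
      gcongr
  have h4 := esize_list_le h2
  rw [List.length_map] at h4
  simp only [Polynomial.eval_add, Polynomial.eval_mul, Polynomial.eval_C, Polynomial.eval_X]
  rw [esize_pair, esize_pair, esize_nat, esize_nat]
  have h5 : l.length * (1 + (1 + (Pref P).ncard * (2 + 2 * m))) ≤
      (m + (Pref P).ncard + n) * (2 + (m + (Pref P).ncard + n) *
        (2 + 2 * (m + (Pref P).ncard + n))) := by
    rw [← add_assoc]
    gcongr <;> omega
  omega

end DFALearning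

namespace DFALearning

open Enc

/-! ### The answers of the solver -/

theorem le_foldr_max {l : List ℕ} {x : ℕ} (h : x ∈ l) : x ≤ l.foldr max 0 := by
  induction l with
  | nil => simp at h
  | cons a l ih =>
    rcases List.mem_cons.1 h with rfl | h
    · exact le_max_left _ _
    · exact (ih h).trans (le_max_right _ _)

theorem foldr_max_le {l : List ℕ} {b : ℕ} (h : ∀ x ∈ l, x ≤ b) : l.foldr max 0 ≤ b := by
  induction l with
  | nil => simp
  | cons a l ih => exact max_le (h a (by simp)) (ih fun x hx => h x (by simp [hx]))

/-- The list of values that encodes an answer. -/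
def answer (φ : Cnf) (o : Option (ℕ → Bool)) : Option (List Bool) :=
  o.map fun v => (List.range φ.numVars).map v

theorem enc_answer (φ : Cnf) (o : Option (ℕ → Bool)) : encAnswer φ o = enc (answer φ o) := by
  cases o <;> rfl

theorem Run.ask_answer (S : SatSolver) (φ : Cnf) :
    Run S .ask (encCnf φ) (enc (answer φ (S.solve φ)))
      (1 + (encCnf φ).size + (enc (answer φ (S.solve φ))).size) [φ] := by
  rw [← enc_answer]
  exact .ask φ

/-- Variable indices are written in unary, so answers are linear in the size of the query. -/
theorem Cnf.numVars_le_size (φ : Cnf) : φ.numVars ≤ φ.size := by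
  refine foldr_max_le fun x hx => ?_
  obtain ⟨l, hl, rfl⟩ := List.mem_map.1 hx
  obtain ⟨C, hC, hlC⟩ := List.mem_flatten.1 hl
  have h1 : esize (α := List Lit) C ≤ φ.size := esize_le_of_mem (α := List Lit) hC
  have h2 : esize (α := Lit) l ≤ esize (α := List Lit) C := esize_le_of_mem (α := Lit) hlC
  have h3 : esize (α := Lit) l = 1 + esize l.2 + esize l.1 := rfl
  rw [esize_nat] at h3
  omega

theorem esize_answer_le (φ : Cnf) (o : Option (ℕ → Bool)) :
    esize (answer φ o) ≤ 3 + 4 * φ.size := by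
  cases o with
  | none =>
    have h1 : esize (answer φ none) = 1 := rfl
    omega
  | some v =>
    have h1 : esize (answer φ (some v)) = 1 + 1 + esize ((List.range φ.numVars).map v) := rfl
    have h2 := esize_bools_le ((List.range φ.numVars).map v)
    have h3 := φ.numVars_le_size
    rw [List.length_map, List.length_range] at h2
    omega

theorem sat_lookup {φ : Cnf} {v : ℕ → Bool} (h : Cnf.Sat v φ) :
    Cnf.Sat (lookup ((List.range φ.numVars).map v)) φ := by
  intro C hC
  obtain ⟨l, hl, hv⟩ := h C hC
  refine ⟨l, hl, ?_⟩
  have : l.1 < φ.numVars :=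
    le_foldr_max (List.mem_map.2 ⟨l, List.mem_flatten.2 ⟨C, hC, hl⟩, rfl⟩)
  rw [lookup, List.getD_eq_getElem _ _ (by simpa using this)]
  simpa using hv

/-! ### The search for the least number of accepted words -/

/-- The numbers of words of length less than `r` accepted by the automata with at most `n` states
that accept the words of `l`. -/
def countValues (m n r : ℕ) (l : List (List ℕ)) : Set ℕ :=
  {x | ∃ δ f, Consistent m n l δ f ∧ countFrom m δ f r 0 = x}

/-- The number of words of length less than `r` accepted by the automaton that is described by a
list of values. -/
def readCount (m n r : ℕ) (best : List Bool) : ℕ :=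
  countFrom m (readStep n (lookup best)) (fun q => !lookup best (varReject q)) r 0

/-- The automaton described by a list of values accepts the words of `l`. -/
def ReadConsistent (m n : ℕ) (l : List (List ℕ)) (best : List Bool) : Prop :=
  Consistent m n l (readStep n (lookup best)) fun q => !lookup best (varReject q)

/-- Under the all-false valuation every transition takes the default value 0 and no state rejects,
so every word is accepted. Having variables for rejection rather than acceptance gives the search an
admissible automaton before the first query. -/
theorem readConsistent_nil {m n : ℕ} (hn : 1 ≤ n) (l : List (List ℕ)) :
    ReadConsistent m n l [] := by
  refine ⟨fun q _ a _ => ?_, fun w _ => by simp [lookup]⟩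
  have h : ((List.range n).flatMap fun _ => ([] : List ℕ)) = [] := by simp
  simpa [readStep, lookup, h] using Nat.lt_of_lt_of_le Nat.one_pos hn

/-- The state of the search for the least number `μ` of accepted words: the bits of `μ` of index
at least `k` are known, and `best` describes an automaton which is optimal up to the bits of
index less than `k`. -/
structure SearchInv (m n r b : ℕ) (l : List (List ℕ)) (μ k : ℕ) (p best : List Bool) : Prop where
  length_add : p.length + k = b
  consistent : ReadConsistent m n l best
  bits : ∀ i < p.length, μ.testBit (k + i) = p.getD i false
  count_le : readCount m n r best / 2 ^ k ≤ μ / 2 ^ k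

section
variable {m n r b : ℕ} {l : List (List ℕ)} {μ k : ℕ} {p best vals : List Bool}

theorem forall_lt_length_cons {c : Bool} {Q : ℕ → Bool → Prop} :
    (∀ i < (c :: p).length, Q i ((c :: p).getD i false)) ↔
      Q 0 c ∧ ∀ i < p.length, Q (i + 1) (p.getD i false) := by
  constructor
  · exact fun h => ⟨h 0 (by simp), fun i hi => h (i + 1) (by simpa using hi)⟩
  · rintro ⟨h0, h1⟩ (_ | i) hi
    · exact h0
    · exact h1 i (by simpa using hi)

theorem div_two_pow_eq (x k : ℕ) :
    x / 2 ^ k = 2 * (x / 2 ^ (k + 1)) + (x.testBit k).toNat := by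
  rw [toNat_testBit, pow_succ, ← Nat.div_div_eq_div_mul]
  omega

theorem lt_two_pow_geomSize (hm : 1 ≤ m) : geomSum m r < 2 ^ geomSize m r := by
  rw [geomSize_eq hm]
  exact Nat.lt_size_self _

/-- The new automaton's count agrees with μ above bit k and has bit k equal to 0. As μ is at most
this count, its bit k is 0 too. -/
theorem SearchInv.of_sat (hm : 1 ≤ m) (hn : 1 ≤ n) (hb : b = geomSize m r)
    (hl : ∀ w ∈ l, ∀ a ∈ w, a < m) (hμ : IsLeast (countValues m n r l) μ)
    (h : SearchInv m n r b l μ (k + 1) p best)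
    (hv : Satisfies (lookup vals) (formula m n r b l k (false :: p))) :
    SearchInv m n r b l μ k (false :: p) vals := by
  have hlen := h.length_add
  obtain ⟨hc, hbits⟩ := formula_sound hn (by omega) hl
    (by simp only [List.length_cons]; omega) hv
  rw [forall_lt_length_cons (Q := fun i c => (countFrom m _ _ r 0).testBit (k + i) = c)] at hbits
  obtain ⟨h0, h1⟩ := hbits
  have hle : μ ≤ readCount m n r vals := hμ.2 ⟨_, _, hc, rfl⟩
  -- Counts have no bits from index b on, so `p` determines everything above bit k.
  have hsmall : ∀ x ≤ geomSum m r, ∀ i, p.length ≤ i → x.testBit (k + 1 + i) = false := by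
    intro x hx i hi
    refine Nat.testBit_lt_two_pow ((hx.trans_lt (lt_two_pow_geomSize hm)).trans_le ?_)
    exact Nat.pow_le_pow_right (by norm_num) (by omega)
  have hcount : readCount m n r vals ≤ geomSum m r := countFrom_le _ _
  have heq : readCount m n r vals / 2 ^ (k + 1) = μ / 2 ^ (k + 1) := by
    refine Nat.eq_of_testBit_eq fun i => ?_
    rw [Nat.testBit_div_two_pow, Nat.testBit_div_two_pow, add_comm i]
    rcases lt_or_ge i p.length with hi | hi
    · rw [h.bits i hi, ← h1 i hi]
      congr 1
      omega
    · rw [hsmall _ hcount i hi, hsmall _ (hle.trans hcount) i hi]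
  have h2 := div_two_pow_eq (readCount m n r vals) k
  have h3 := div_two_pow_eq μ k
  have h4 : μ / 2 ^ k ≤ readCount m n r vals / 2 ^ k := Nat.div_le_div_right hle
  have h0' : ((readCount m n r vals).testBit k).toNat = 0 := by
    rw [show (readCount m n r vals).testBit k = false from h0]; rfl
  have hμ0 : μ.testBit k = false := by
    rw [← Bool.toNat_eq_zero]
    omega
  refine ⟨by simp only [List.length_cons]; omega, hc, ?_, by omega⟩
  rw [forall_lt_length_cons (Q := fun i c => μ.testBit (k + i) = c)]
  refine ⟨hμ0, fun i hi => ?_⟩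
  rw [← h.bits i hi]
  congr 1
  omega

/-- If bit k of μ were 0, an automaton with count μ would satisfy the query. The old automaton can
be kept: its count is at most μ up to the bits below k + 1, and its bit k cannot exceed the bit 1 of
μ. -/
theorem SearchInv.of_unsat (hm : 1 ≤ m) (hb : b = geomSize m r)
    (hμ : IsLeast (countValues m n r l) μ) (h : SearchInv m n r b l μ (k + 1) p best)
    (hv : ∀ v, ¬ Satisfies v (formula m n r b l k (false :: p))) :
    SearchInv m n r b l μ k (true :: p) best := by
  have hlen := h.length_add
  have hshift : ∀ i < p.length, μ.testBit (k + (i + 1)) = p.getD i false := by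
    intro i hi
    rw [← h.bits i hi]
    congr 1
    omega
  have hμ1 : μ.testBit k = true := by
    by_contra hμ0
    rw [Bool.not_eq_true] at hμ0
    obtain ⟨δ, f, hc, rfl⟩ := hμ.1
    refine hv _ (formula_complete hm (hb ▸ lt_two_pow_geomSize hm) hc ?_)
    rw [forall_lt_length_cons (Q := fun i c => (countFrom m δ f r 0).testBit (k + i) = c)]
    exact ⟨hμ0, hshift⟩
  refine ⟨by simp only [List.length_cons]; omega, h.consistent, ?_, ?_⟩
  · rw [forall_lt_length_cons (Q := fun i c => μ.testBit (k + i) = c)]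
    exact ⟨hμ1, hshift⟩
  · have h2 := div_two_pow_eq (readCount m n r best) k
    have h3 := div_two_pow_eq μ k
    have h4 := Bool.toNat_le ((readCount m n r best).testBit k)
    have h5 := h.count_le
    rw [hμ1, Bool.toNat_true] at h3
    omega

end

/-! ### The program -/

/-- The number of bits of the numbers of accepted words, and the input. -/
abbrev SearchEnv : Type := ℕ × ℕ × ℕ × List (List ℕ)

/-- The query in the search, if the bits `p` are known, and `k` is the index of the next bit. -/
def searchQuery (x : ℕ × List Bool × SearchEnv) : List (List Lit) :=
  formula x.2.2.2.1 x.2.2.2.2.1 (x.2.2.2.2.1 + (x.2.2.2.2.1 - 1)) x.2.2.1 x.2.2.2.2.2 x.1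
    (false :: x.2.1)

/-- `searchQuery` as a formula for the solver. -/
def searchCnf (x : ℕ × List Bool × SearchEnv) : Cnf := searchQuery x

/-- The update of the state of the search after an answer of the solver. -/
def searchUpdate (x : Option (List Bool) × (Unit × ℕ) × (List Bool × List Bool) × SearchEnv) :
    ℕ × (List Bool × List Bool) × SearchEnv :=
  (x.2.1.2, bif x.1.isSome then (false :: x.2.2.1.1, x.1.getD [])
    else (true :: x.2.2.1.1, x.2.2.1.2), x.2.2.2)

/-- The initial state of the search. -/
def searchInit (x : ℕ × ℕ × List (List ℕ)) : ℕ × (List Bool × List Bool) × SearchEnv :=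
  (geomSize x.1 (x.2.1 + (x.2.1 - 1)), ([], []), geomSize x.1 (x.2.1 + (x.2.1 - 1)), x)

theorem PT.searchQuery : PT searchQuery := by
  unfold DFALearning.searchQuery; fun_prop

theorem PT.searchUpdate : PT searchUpdate := by
  unfold DFALearning.searchUpdate; fun_prop

theorem PT.searchInit : PT searchInit := by
  unfold DFALearning.searchInit; fun_prop

/-- The number k + 1 and the pair ((), k) are the same datum, so the loop body gets its decremented
counter by a mere projection. The state is paired with the answer because a call of the solver would
otherwise overwrite it. -/
theorem exists_search_step : ∃ (p : Prog) (T : Polynomial ℕ), ∀ (S : SatSolver) (k : ℕ)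
    (p' best : List Bool) (e : SearchEnv), ∃ t,
      Run S p (enc (k + 1, (p', best), e))
        (enc (searchUpdate (answer (searchCnf (k, p', e)) (S.solve (searchCnf (k, p', e))),
          ((), k), (p', best), e))) t [searchCnf (k, p', e)] ∧
      t ≤ T.eval (esize (k + 1, (p', best), e)) := by
  have hq : PT fun x : (Unit × ℕ) × (List Bool × List Bool) × SearchEnv =>
      searchQuery (x.1.2, x.2.1.1, x.2.2) := PT.searchQuery.comp (by fun_prop)
  obtain ⟨q, Q, hq⟩ := hq
  obtain ⟨u, U, hu⟩ := PT.searchUpdate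
  have hT : PB fun x : (Unit × ℕ) × (List Bool × List Bool) × SearchEnv =>
      1 + esize x + (1 + esize x + (1 + esize x + Q.eval (esize x) + (1 + Q.eval (esize x) +
        (3 + 4 * Q.eval (esize x)))) + (1 + esize x)) +
        U.eval (1 + (3 + 4 * Q.eval (esize x)) + esize x) := by
    have hs : PB fun x : (Unit × ℕ) × (List Bool × List Bool) × SearchEnv => esize x := .self
    have hQ := hs.eval Q
    have ha := (PB.const 3).add ((PB.const 4).mul hQ)
    have h1 := (PB.const 1).add hs
    exact (h1.add ((h1.add ((h1.add hQ).add (((PB.const 1).add hQ).add ha))).add h1)).add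
      ((((PB.const 1).add ha).add hs).eval U)
  obtain ⟨T, hT⟩ := hT
  refine ⟨.seq (.pair (.seq q .ask) .id) u, T, fun S k p' best e => ?_⟩
  obtain ⟨tq, hrq, htq⟩ := hq S (((), k), (p', best), e)
  have hφ : (encCnf (searchCnf (k, p', e))).size ≤ Q.eval (esize (((), k), (p', best), e)) :=
    hrq.size_le.trans htq
  obtain ⟨tu, hru, htu⟩ := hu S (answer (searchCnf (k, p', e))
    (S.solve (searchCnf (k, p', e))), ((), k), (p', best), e)
  have hans := esize_answer_le (searchCnf (k, p', e)) (S.solve (searchCnf (k, p', e)))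
  have hask := Run.ask_answer S (searchCnf (k, p', e))
  refine ⟨_, .seq (.pair (.seq hrq hask) (.id _)) hru, le_trans ?_ (hT (((), k), (p', best), e))⟩
  have h2 : (enc (answer (searchCnf (k, p', e)) (S.solve (searchCnf (k, p', e))))).size ≤
      3 + 4 * Q.eval (esize (((), k), (p', best), e)) :=
    hans.trans (Nat.add_le_add_left (Nat.mul_le_mul_left 4 hφ) 3)
  have h3 : tu ≤ U.eval (1 + (3 + 4 * Q.eval (esize (((), k), (p', best), e))) +
      esize (((), k), (p', best), e)) := by
    refine htu.trans (eval_mono U ?_)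
    rw [esize_pair _ (((), k), (p', best), e)]
    exact Nat.add_le_add_right (Nat.add_le_add_left h2 1) _
  have h4 : (enc (((), k), (p', best), e)).size = esize (((), k), (p', best), e) := rfl
  simp only [h4]
  omega

/-- There is one round, with one query, for each bit. At the start no bit is known and the invariant
bounds a quotient that is 0; at k = 0 it says that the stored automaton's count is at most μ. -/
theorem exists_program : ∃ (p : Prog) (T : Polynomial ℕ), ∀ (S : SatSolver) (m n : ℕ)
    (l : List (List ℕ)), 1 ≤ m → 1 ≤ n → (∀ w ∈ l, ∀ a ∈ w, a < m) →
    ∃ (best : List Bool) (t : ℕ) (qs : List Cnf),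
      Run S p (enc (m, n, l)) (enc (readDFA m n best)) t qs ∧ t ≤ T.eval (esize (m, n, l)) ∧
      qs.length ≤ geomSize m (n + (n - 1)) ∧ (∀ φ ∈ qs, φ.size ≤ T.eval (esize (m, n, l))) ∧
      ReadConsistent m n l best ∧
      readCount m n (n + (n - 1)) best ∈ lowerBounds (countValues m n (n + (n - 1)) l) := by
  obtain ⟨pstep, Ts, hstep⟩ := exists_search_step
  obtain ⟨Q, hQ⟩ := PT.searchQuery.pb_esize
  obtain ⟨pstart, Ti, hstart⟩ := PT.searchInit
  have hout : PT fun x : ℕ × (List Bool × List Bool) × SearchEnv =>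
    readDFA x.2.2.2.1 x.2.2.2.2.1 x.2.1.2 := by fun_prop
  obtain ⟨pout, To, hout⟩ := hout
  -- the size of the state without its last automaton, of a query, and of the whole state
  let B : ℕ × ℕ × List (List ℕ) → ℕ := fun x => geomSize x.1 (x.2.1 + (x.2.1 - 1))
  let M₀ : ℕ × ℕ × List (List ℕ) → ℕ := fun x => 10 + 8 * esize (B x) + esize x
  let Z : ℕ × ℕ × List (List ℕ) → ℕ := fun x => Q.eval (M₀ x)
  let M : ℕ × ℕ × List (List ℕ) → ℕ := fun x => 1 + M₀ x + (1 + 4 * Z x)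
  let L : ℕ × ℕ × List (List ℕ) → ℕ := fun x => (esize (B x) + 1) * (1 + M x + Ts.eval (M x))
  have hB : PB fun x => esize (B x) := by
    have : PT B := by fun_prop
    exact this.pb_esize
  have hM₀ : PB M₀ := ((PB.const 10).add ((PB.const 8).mul hB)).add .self
  have hZ : PB Z := hM₀.eval Q
  have hM : PB M := ((PB.const 1).add hM₀).add ((PB.const 1).add ((PB.const 4).mul hZ))
  have hL : PB L := (hB.add (.const 1)).mul (((PB.const 1).add hM).add (hM.eval Ts))
  have hT : PB fun x => 1 + esize x + Ti.eval (esize x) +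
      (1 + M x + L x + To.eval (M x)) + Z x :=
    ((((PB.const 1).add .self).add (PB.self.eval Ti)).add
      ((((PB.const 1).add hM).add hL).add (hM.eval To))).add hZ
  obtain ⟨T, hT⟩ := hT
  refine ⟨.seq pstart (.seq (.loop pstep) pout), T, fun S m n l hm hn hl => ?_⟩
  set x : ℕ × ℕ × List (List ℕ) := (m, n, l) with hx
  set r := n + (n - 1) with hr
  obtain ⟨μ, hμ⟩ : ∃ μ, IsLeast (countValues m n r l) μ :=
    ⟨_, Nat.sInf_mem ⟨_, _, _, readConsistent_nil hn l, rfl⟩, fun y hy => Nat.sInf_le hy⟩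
  -- A query depends on the known bits and the input, not on `best`. Since answers replace `best`
  -- instead of extending it, sizes do not accumulate over the rounds.
  have hquery : ∀ k p', p'.length + k ≤ B x →
      Cnf.size (searchCnf (k, p', B x, x)) ≤ Z x := by
    intro k p' hk
    refine (hQ (k, p', B x, x)).trans (eval_mono Q ?_)
    have := esize_bools_le p'
    simp only [M₀, esize_pair k, esize_pair p', esize_pair (B x), esize_nat]
    omega
  have hstate : ∀ (k : ℕ) (p' best : List Bool), p'.length + k = B x → best.length ≤ Z x →
      esize (k, (p', best), B x, x) ≤ M x := by
    intro k p' best hk hbest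
    have h1 := esize_bools_le p'
    have h2 := esize_bools_le best
    simp only [M, M₀, esize_pair k, esize_pair p', esize_pair (B x), esize_pair (p', best),
      esize_nat]
    omega
  obtain ⟨y, t, qs, hrun, ht, hlen, hsize, p', best, rfl, hbest, hinv⟩ :=
    Run.loop_of_invariant (S := S) (p := pstep)
      (fun k d => ∃ p' best, d = enc (k, (p', best), B x, x) ∧ best.length ≤ Z x ∧
        SearchInv m n r (B x) l μ k p' best)
      (T := Ts.eval (M x)) (M := M x) (r := 1) (Z := Z x)
      (by
        rintro k _ ⟨p', best, rfl, hbest, hinv⟩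
        exact hstate k p' best hinv.length_add hbest)
      (by
        rintro _ ⟨p', best, rfl, -⟩
        rfl)
      (by
        rintro k _ ⟨p', best, rfl, hbest, hinv⟩
        obtain ⟨t, hrun, ht⟩ := hstep S k p' best (B x, x)
        have hk := hinv.length_add
        have hz := hquery k p' (by omega)
        refine ⟨by simp [Data.hd], _, t, _, hrun,
          ht.trans (eval_mono _ (hstate (k + 1) p' best hk hbest)), le_rfl, by simpa using hz, ?_⟩
        rcases hs : S.solve (searchCnf (k, p', B x, x)) with _ | v
        · exact ⟨true :: p', best, rfl, hbest,
            hinv.of_unsat hm rfl hμ (S.complete _ hs)⟩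
        · refine ⟨false :: p', _, rfl, ?_, hinv.of_sat hm hn rfl hl hμ
            (sat_lookup (S.sound _ _ hs))⟩
          rw [answer, Option.map_some, Option.getD_some, List.length_map, List.length_range]
          exact (Cnf.numVars_le_size _).trans hz)
      (B x) (enc (searchInit x))
      ⟨[], [], rfl, by simp, by simp, readConsistent_nil hn l, by simp, by
        have h1 : readCount m n r [] < 2 ^ B x :=
          (countFrom_le _ _).trans_lt (lt_two_pow_geomSize hm)
        rw [Nat.div_eq_of_lt h1]
        exact Nat.zero_le _⟩
  obtain ⟨ti, hri, hti⟩ := hstart S x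
  obtain ⟨tout, hro, hto⟩ := hout S (0, (p', best), B x, x)
  have hTx := hT x
  simp only at hTx
  refine ⟨best, _, _, .seq hri (.seq hrun hro), ?_, ?_, ?_, hinv.consistent, ?_⟩
  · have h1 : (enc (searchInit x)).size ≤ M x := hstate _ [] [] (by simp [B]) (by simp)
    have h2 := hto.trans (eval_mono To (hstate 0 p' best hinv.length_add hbest))
    have h3 : t ≤ L x := ht.trans (Nat.mul_le_mul_right _ (by rw [esize_nat]; omega))
    have h4 : (enc x).size = esize x := rfl
    rw [h4]
    omega
  · simpa [B] using hlen
  · intro φ hφ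
    have := hsize φ (by simpa using hφ)
    omega
  · have := hinv.count_le
    simp only [pow_zero, Nat.div_one] at this
    exact fun y hy => this.trans (hμ.2 hy)

end DFALearning

/-! ### Optimality of the output, and the final bounds -/

namespace DFALearning

theorem geomSize_le_pow {m n : ℕ} (hm : 1 ≤ m) (hn : 1 ≤ n) :
    geomSize m (n + (n - 1)) ≤ 2 * (m + n) ^ 2 := by
  refine (geomSize_le hm).trans ?_
  calc m * (n + (n - 1)) ≤ (m + n) * (2 * (m + n)) := Nat.mul_le_mul (by omega) (by omega)
    _ = 2 * (m + n) ^ 2 := by ring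

/-- Every competitor, even one with fewer states, is represented on n numbers, so its count lies in
`countValues`. -/
theorem solvesTask_numDFA {m n : ℕ} {P : Set (List (Fin m))} {l : List (List (Fin m))}
    (hn : 1 ≤ n) (hl : ∀ w, w ∈ l ↔ w ∈ P) {δ : ℕ → ℕ → ℕ} {f : ℕ → Bool}
    (hc : Consistent m n (l.map (List.map Fin.val)) δ f)
    (hmin : countFrom m δ f (n + (n - 1)) 0 ∈
      lowerBounds (countValues m n (n + (n - 1)) (l.map (List.map Fin.val)))) :
    SolvesTask P n { State := Fin n, toDFA := numDFA hn δ f hc.step_lt } := by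
  have hrep := represents_numDFA hn δ f hc.step_lt
  -- `countFrom` counts words strictly shorter than its argument, so length at most 2n - 2
  -- corresponds to 2n - 1; truncated subtraction makes 1 ≤ n necessary.
  have hr : 2 * n - 2 + 1 = n + (n - 1) := by omega
  refine ⟨⟨(Fintype.card_fin n).le, (hrep.consistent_iff hc.step_lt hl).1 hc⟩, ?_⟩
  rintro A ⟨hA, hPA⟩
  obtain ⟨δ', f', hδ', hrep'⟩ := exists_represents A hA
  rw [CountLT, hrep.count_eq, hrep'.count_eq, hr, not_lt]
  exact hmin ⟨δ', f', (hrep'.consistent_iff hδ' hl).2 hPA, rfl⟩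

end DFALearning

theorem mainTheorem3 :
    ∃ (p : DFALearning.Prog) (c : ℕ),
      ∀ (S : DFALearning.SatSolver) (m n : ℕ), 1 ≤ m → 1 ≤ n →
      ∀ (P : Set (List (Fin m))) (l : List (List (Fin m))),
        l.Nodup → (∀ w, w ∈ l ↔ w ∈ P) →
        ∃ (s : ℕ) (A : DFA (Fin m) (Fin s)) (t : ℕ) (qs : List DFALearning.Cnf),
          DFALearning.Run S p (DFALearning.encInput m n l) (DFALearning.encDFA A) t qs ∧
          DFALearning.SolvesTask P n { State := Fin s, toDFA := A } ∧
          t ≤ c * (m + (DFALearning.Pref P).ncard + n) ^ c ∧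
          qs.length ≤ c * (m + n) ^ c ∧
          (2 ≤ m → (qs.length : ℝ) ≤ (2 * (n : ℝ) - 1) * Real.logb 2 (m : ℝ)) ∧
          ∀ φ ∈ qs, φ.size ≤ c * (m + (DFALearning.Pref P).ncard + n) ^ c := by
  open DFALearning in
  obtain ⟨p, T, hp⟩ := exists_program
  obtain ⟨c, hc⟩ := exists_eval_le_mul_pow (T.comp (Polynomial.C 5 + Polynomial.C 2 * Polynomial.X +
    Polynomial.X * (Polynomial.C 2 + Polynomial.X * (Polynomial.C 2 +
      Polynomial.C 2 * Polynomial.X))))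
  -- The summand 2 covers the bound 2(m + n)² on the number of queries.
  refine ⟨p, c + 2, fun S m n hm hn P l hnd hl => ?_⟩
  obtain ⟨best, t, qs, hrun, ht, hlen, hsize, hcons, hmin⟩ :=
    hp S m n (l.map (List.map Fin.val)) hm hn (by
      intro w hw a ha
      obtain ⟨w, -, rfl⟩ := List.mem_map.1 hw
      obtain ⟨a, -, rfl⟩ := List.mem_map.1 ha
      exact a.2)
  have hN : 1 ≤ m + (Pref P).ncard + n := by omega
  have hbound : T.eval (esize (m, n, l.map (List.map Fin.val))) ≤
      (c + 2) * (m + (Pref P).ncard + n) ^ (c + 2) := by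
    refine (eval_mono T (esize_input_le hnd hl)).trans ?_
    rw [← Polynomial.eval_comp]
    exact (hc _ hN).trans (mul_pow_self_mono (by omega) hN)
  refine ⟨n, numDFA hn _ _ hcons.step_lt, t, qs, ?_, solvesTask_numDFA hn hl hcons hmin,
    ht.trans hbound, ?_, fun hm2 => ?_, fun φ hφ => (hsize φ hφ).trans hbound⟩
  · rw [encInput_eq, encDFA_numDFA]
    exact hrun
  · exact (hlen.trans (geomSize_le_pow hm hn)).trans (mul_pow_self_mono (by omega) (by omega))
  · have h1 : (qs.length : ℝ) ≤ geomSize m (n + (n - 1)) := Nat.cast_le.2 hlen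
    have h2 := geomSize_le_logb (r := n + (n - 1)) hm2 (by omega)
    have h3 : ((n + (n - 1) : ℕ) : ℝ) = 2 * (n : ℝ) - 1 := by
      push_cast [Nat.cast_sub hn]
      ring
    rw [h3] at h2
    exact h1.trans h2
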